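/- **Setting.** Let $U,\bar U\subseteq\mathbb R^2$ be open and consider two smooth (pseudo-)Riemannian metrics, of arbitrary signature, $$\mathbf g=b_{ij}(t)\,dt^i dt^j+2f_{ik}(t)\,dt^i dz^k+h_{kl}(t)\,dz^k dz^l,\qquad \bar{\mathbf g}=\bar b_{mn}(\bar t)\,d\bar t^m d\bar t^n+2\bar f_{mr}(\bar t)\,d\bar t^m d\bar z^r+\bar h_{rs}(\bar t)\,d\bar z^r d\bar z^s$$ on $U\times\mathbb R^2$ and $\bar U\times\mathbb R^2$ (indices run over $1,2$; $b,h$ symmetric), with $\det(h_{kl})\neq0$ and $\det(\bar h_{kl})\ne 0$ everywhere. Assume that the Killing algebra of each metric is exactly the span of $\partial_{z^1},\partial_{z^2}$ (resp. $\partial_{\bar z^1},\partial_{\bar z^2}$), i.e. every Killing field on a connected open set is a constant linear combination of these. For $\mathbf g$ put $f^k_j=f_{js}h^{sk}$, $\tilde g_{ij}=b_{ij}-f_{ik}f_{jl}h^{kl}$, $\sigma=d(\det h)/\det h$, $\rho=\sigma^2$, $\chi=(dh_{11}dh_{22}-dh_{12}^2)/\det h$, $\gamma=\chi-\frac14\rho$,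 and $C_\mu=\mu_{ij}\tilde g^{ij}$, $Q_\mu=\det\mu/\det\tilde g$ for a symmetric form $\mu$. Define $$\mathcal C^k=\frac{\partial_{t^2}f^k_1-\partial_{t^1}f^k_2}{\sqrt{|\det\tilde g|}},\quad (\mathcal C^\perp)^1=\frac{h_{s2}\mathcal C^s}{\sqrt{|\det h|}},\quad(\mathcal C^\perp)^2=\frac{-h_{s1}\mathcal C^s}{\sqrt{|\det h|}},\quad \ell_{\mathcal C}=h_{kl}\mathcal C^k\mathcal C^l,$$ $$\mathcal H^i=-\tfrac12\tilde g^{is}\sigma_s,\quad(\mathcal H^\perp)^1=-\frac{\sigma_2}{2\sqrt{|\det\tilde g|}},\quad(\mathcal H^\perp)^2=\frac{\sigma_1}{2\sqrt{|\det\tilde g|}},$$ $$\Theta_{\mathrm I}=\frac1{\sqrt{|\det h|\,|\det\tilde g|}}\begin{vmatrix}h_{11,1}&h_{12,1}&h_{22,1}\\h_{11,2}&h_{12,2}&h_{22,2}\\(\mathcal C^2)^2&-\mathcal C^1\mathcal C^2&(\mathcal C^1)^2\end{vmatrix},$$ and $(I_1,\dots,I_6)=(C_\rho,C_\chi,Q_\chi,Q_\gamma,\ell_{\mathcal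 C},\Theta_{\mathrm I}^2)$, all functions of $t\in U$; the same objects of $\bar{\mathbf g}$, functions of $\bar t\in\bar U$, carry a bar. Two functions of $t$ are *functionally independent* on a region if their Jacobian determinant vanishes nowhere there. For vectors $X,Y\in\mathbb R^2$ write $(X\mid Y)$ for the matrix with columns $X,Y$. The metrics are *equivalent* if there is an isometry, i.e. a smooth diffeomorphism $\Phi$ with $\Phi^*\bar{\mathbf g}=\mathbf g$, from some nonempty open subset of $U\times\mathbb R^2$ onto an open subset of $\bar U\times\mathbb R^2$; they are equivalent at $(p,\bar p)$ if moreover $p$ is in the domain of $\Phi$ and $\Phi(p)=\bar p$. **Theorem.** Assume $\ell_{\mathcal C}C_\rho\neq0$ everywhere on $U$, $\bar\ell_{\bar{\mathcal C}}\bar C_{\bar\rho}\ne0$ everywhere on $\bar U$, and that some two of the invariants $I_1,\dots,I_6$ of $\mathbf g$ are functionally independent on $U$. Then $\mathbf g$ and $\bar{\mathbf g}$ are equivalent if and only if there exist a nonempty open $V\subseteq U$ and a coordinate transformation $$P:\quad\bar t^i=\phi^i(t^1,t^2),\qquad\bar z^i=\alpha^i_jz^j+\psi^i(t^1,t^2),\qquad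 t\in V,\ z\in\mathbb R^2,\ (\alpha^i_j)\in\mathrm{GL}(2,\mathbb R),$$ with $\phi:V\to\bar U$ smooth and injective, $J_\phi=\det(\partial\phi^i/\partial t^j)\ne0$, and $\psi$ smooth, such that, with $\epsilon_1=\operatorname{sgn}J_\phi$, $\epsilon_2=\operatorname{sgn}\det\alpha$, unbarred objects evaluated at $t\in V$ and barred ones at $\bar t=\phi(t)$: (i) for some $a,b\in\{1,\dots,6\}$, $I_a,I_b$ are functionally independent on $V$, $\bar I_a,\bar I_b$ are functionally independent on $\phi(V)$, and $\bar t=\phi(t)$ is implicitly defined by $I_a(t)=\bar I_a(\bar t)$, $I_b(t)=\bar I_b(\bar t)$ (for each $t_0\in V$, these equations are equivalent to $\bar t=\phi(t)$ for $(t,\bar t)$ near $(t_0,\phi(t_0))$); (ii) $\epsilon_1\,(\bar{\mathcal C}\mid\epsilon_2\bar{\mathcal C}^\perp)\,(\mathcal C\mid\mathcal C^\perp)^{-1}$ is a constant matrix, equal to $\alpha=(\alpha^i_j)$; (iii) $\left(\partial\phi^i/\partial t^j\right)=(\bar{\mathcal H}\mid\epsilon_1\bar{\mathcal H}^\perp)\,(\mathcal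 H\mid\mathcal H^\perp)^{-1}$; (iv) the first-order system $\left(\partial\psi^i/\partial t^j\right)=\alpha\,(f^i_j)-(\bar f^i_j)\,(\bar{\mathcal H}\mid\epsilon_1\bar{\mathcal H}^\perp)\,(\mathcal H\mid\mathcal H^\perp)^{-1}$ is integrable (its right-hand side $R^i_j$ satisfies $\partial_{t^2}R^i_1=\partial_{t^1}R^i_2$) and is satisfied by $\psi$; (v) the transformation rules hold: $$b_{ij}=\bar b_{mn}\frac{\partial\phi^m}{\partial t^i}\frac{\partial\phi^n}{\partial t^j}+\bar f_{mr}\Big(\frac{\partial\phi^m}{\partial t^i}\frac{\partial\psi^r}{\partial t^j}+\frac{\partial\phi^m}{\partial t^j}\frac{\partial\psi^r}{\partial t^i}\Big)+\bar h_{rs}\frac{\partial\psi^r}{\partial t^i}\frac{\partial\psi^s}{\partial t^j},$$ $$f_{ik}=\bar f_{mr}\alpha^r_k\frac{\partial\phi^m}{\partial t^i}+\bar h_{rs}\alpha^r_k\frac{\partial\psi^s}{\partial t^i},\qquad h_{kl}=\bar h_{rs}\alpha^r_k\alpha^s_l.$$ More precisely, for all $p\in U\times\mathbb R^2$ and $\bar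 p\in\bar U\times\mathbb R^2$ the metrics are equivalent at $(p,\bar p)$ if and only if there is such a $P$ defined at $p$ with $P(p)=\bar p$. -/

import Mathlib

open scoped ContDiff Topology

noncomputable section

/-- The coordinate plane; both `t = (t¹, t²)` and `z = (z¹, z²)` range over it. -/
abbrev Plane : Type := Fin 2 → ℝ

/-- Real `2 × 2` matrices. -/
abbrev Mat2 : Type := Matrix (Fin 2) (Fin 2) ℝ

/-- The partial derivative `∂F/∂tⁱ`. -/
def pd (i : Fin 2) (F : Plane → ℝ) (t : Plane) : ℝ :=
  fderiv ℝ F t (Pi.single i 1)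

/-- The Jacobian matrix of a map of the plane, row `i`, column `j` being `∂φⁱ/∂tʲ`. -/
def jac (φ : Plane → Plane) (t : Plane) : Mat2 :=
  Matrix.of fun i j => pd j (fun s => φ s i) t

/-- The matrix with columns `X` and `ε Y`. -/
def colMatrix (ε : ℝ) (X Y : Plane) : Mat2 :=
  !![X 0, ε * Y 0; X 1, ε * Y 1]

/-- Functional independence on a region of the plane: `dF ∧ dG` vanishes nowhere on it. -/
def FunctionallyIndependentOn (F G : Plane → ℝ) (V : Set Plane) : Prop :=
  ∀ t ∈ V, pd 0 F t * pd 1 G t - pd 1 F t * pd 0 G t ≠ 0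

/-- A (pseudo-)Riemannian metric
`b_{ij}(t) dtⁱ dtʲ + 2 f_{ik}(t) dtⁱ dzᵏ + h_{kl}(t) dzᵏ dzˡ` in adapted coordinates `(t, z)`,
`t ∈ U`, `z ∈ ℝ²`, of arbitrary signature and with non-null Killing leaves `t = const`. -/
structure AdaptedMetric where
  U : Set Plane
  isOpen_U : IsOpen U
  b : Plane → Mat2
  f : Plane → Mat2
  h : Plane → Mat2
  smooth_b : ∀ i j, ContDiffOn ℝ ∞ (fun t => b t i j) U
  smooth_f : ∀ i k, ContDiffOn ℝ ∞ (fun t => f t i k) U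
  smooth_h : ∀ k l, ContDiffOn ℝ ∞ (fun t => h t k l) U
  symm_b : ∀ t ∈ U, (b t).IsSymm
  symm_h : ∀ t ∈ U, (h t).IsSymm
  nondegenerate : ∀ t ∈ U, (Matrix.fromBlocks (b t) (f t) (f t).transpose (h t)).det ≠ 0
  leaves_nonnull : ∀ t ∈ U, (h t).det ≠ 0

namespace AdaptedMetric

variable (g : AdaptedMetric)

/-- The coordinate domain `U × ℝ²` of the metric. -/
def domain : Set (Plane × Plane) := {q | q.1 ∈ g.U}

/-- The value `g_q(v, w)` on tangent vectors `v = (dt, dz)`, `w` at the point `q = (t, z)`. -/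
def form (q v w : Plane × Plane) : ℝ :=
  (∑ i, ∑ j, g.b q.1 i j * v.1 i * w.1 j)
    + (∑ i, ∑ k, g.f q.1 i k * (v.1 i * w.2 k + w.1 i * v.2 k))
    + ∑ k, ∑ l, g.h q.1 k l * v.2 k * w.2 l

/-- `X` is a Killing field on `W`, i.e. the Lie derivative of `g` along `X` vanishes there. -/
def IsKillingOn (X : Plane × Plane → Plane × Plane) (W : Set (Plane × Plane)) : Prop :=
  ∀ q ∈ W, ∀ v w : Plane × Plane,
    fderiv ℝ (fun r => g.form r v w) q (X q)
      + g.form q (fderiv ℝ X q v) w + g.form q v (fderiv ℝ X q w) = 0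

/-- The Killing algebra of `g` is exactly the span of `∂/∂z¹`, `∂/∂z²`: every Killing field
on a connected open set of the domain is a constant combination of these two
(that these two are Killing fields is automatic). -/
def KillingAlgebraIsG2 : Prop :=
  ∀ W : Set (Plane × Plane), IsOpen W → IsPreconnected W → W ⊆ g.domain →
    ∀ X : Plane × Plane → Plane × Plane, ContDiffOn ℝ ∞ X W → g.IsKillingOn X W →
      ∃ c : Plane, ∀ q ∈ W, X q = (0, c)

/-- `f_j^k = f_{js} h^{sk}`, as the matrix with row index `k` and column index `j`. -/
def fUp (t : Plane) : Mat2 :=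
  Matrix.of fun k j => ∑ s, g.f t j s * (g.h t)⁻¹ s k

/-- The orbit metric `g̃_{ij} = b_{ij} - f_{ik} f_{jl} h^{kl}`. -/
def orbit (t : Plane) : Mat2 :=
  Matrix.of fun i j => g.b t i j - ∑ k, ∑ l, g.f t i k * g.f t j l * (g.h t)⁻¹ k l

/-- `det h`. -/
def detH (t : Plane) : ℝ := (g.h t).det

/-- `√|det g̃|`. -/
def sqrtOrbit (t : Plane) : ℝ := √|(g.orbit t).det|

/-- The partial derivative `h_{kl,i}`. -/
def dh (k l i : Fin 2) (t : Plane) : ℝ := pd i (fun s => g.h s k l) t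

/-- The 1-form `σ = d(det h) / det h`. -/
def sigma (t : Plane) : Plane := fun i => pd i g.detH t / g.detH t

/-- `ρ = σ²`. -/
def rho (t : Plane) : Mat2 := Matrix.of fun i j => g.sigma t i * g.sigma t j

/-- `χ = (dh₁₁ dh₂₂ - dh₁₂ dh₁₂) / det h`, a symmetric product of 1-forms. -/
def chi (t : Plane) : Mat2 :=
  Matrix.of fun i j =>
    1 / (2 * g.detH t) *
      ((g.dh 0 0 i t * g.dh 1 1 j t - g.dh 0 1 j t * g.dh 1 0 i t)
        + (g.dh 0 0 j t * g.dh 1 1 i t - g.dh 0 1 i t * g.dh 1 0 j t))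

/-- `γ = χ - ρ / 4`. -/
def gamma (t : Plane) : Mat2 := g.chi t - (1 / 4 : ℝ) • g.rho t

/-- `C_μ = μ_{ij} g̃^{ij}`. -/
def traceInv (μ : Plane → Mat2) (t : Plane) : ℝ :=
  ∑ i, ∑ j, μ t i j * (g.orbit t)⁻¹ i j

/-- `Q_μ = det μ / det g̃`. -/
def detInv (μ : Plane → Mat2) (t : Plane) : ℝ := (μ t).det / (g.orbit t).det

/-- `C_ρ`. -/
def Crho : Plane → ℝ := g.traceInv g.rho

/-- The components `𝒞ᵏ` of the curvature vector field
`𝒞 = ver [hor ∂_{t¹}, hor ∂_{t²}] / √|det g̃|`. -/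
def curv (t : Plane) : Plane := fun k =>
  (pd 1 (fun s => g.fUp s k 0) t - pd 0 (fun s => g.fUp s k 1) t) / g.sqrtOrbit t

/-- The components of `𝒞^⊥`, the orthogonal complement of `𝒞` in the Killing leaves. -/
def curvPerp (t : Plane) : Plane :=
  ![(∑ s, g.h t s 1 * g.curv t s) / √|g.detH t|,
    -(∑ s, g.h t s 0 * g.curv t s) / √|g.detH t|]

/-- `ℓ_𝒞 = g(𝒞, 𝒞)`. -/
def ellC (t : Plane) : ℝ := ∑ k, ∑ l, g.h t k l * g.curv t k * g.curv t l

/-- The components `ℋⁱ` of the mean curvature vector field of the leaves with respect to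
the horizontal lifts of `∂/∂tⁱ`. -/
def mean (t : Plane) : Plane := fun i =>
  -(1 / 2) * ∑ s, (g.orbit t)⁻¹ i s * (pd s g.detH t / g.detH t)

/-- The components of `ℋ^⊥` with respect to the horizontal lifts of `∂/∂tⁱ`. -/
def meanPerp (t : Plane) : Plane :=
  ![-(1 / 2) * (pd 1 g.detH t / (g.detH t * g.sqrtOrbit t)),
    (1 / 2) * (pd 0 g.detH t / (g.detH t * g.sqrtOrbit t))]

/-- The semi-invariant `Θ_I`. -/
def thetaI (t : Plane) : ℝ :=
  1 / (√|g.detH t| * g.sqrtOrbit t) *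
    Matrix.det !![g.dh 0 0 0 t, g.dh 0 1 0 t, g.dh 1 1 0 t;
                  g.dh 0 0 1 t, g.dh 0 1 1 t, g.dh 1 1 1 t;
                  g.curv t 1 ^ 2, -(g.curv t 0 * g.curv t 1), g.curv t 0 ^ 2]

/-- The six fundamental first-order invariants
`C_ρ, C_χ, Q_χ, Q_γ, ℓ_𝒞, (Θ_I)²` evaluated on the metric. -/
def inv : Fin 6 → Plane → ℝ :=
  ![g.Crho, g.traceInv g.chi, g.detInv g.chi, g.detInv g.gamma, g.ellC,
    fun t => g.thetaI t ^ 2]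

end AdaptedMetric

/-- The germs of `g` at `p` and of `g'` at `p'` are equivalent: there is a smooth
diffeomorphism (an arbitrary one, not required to respect the adapted coordinates) between
neighbourhoods of `p` and `p'` that maps `p` to `p'` and pulls `g'` back to `g`. -/
def EquivalentAt (g g' : AdaptedMetric) (p p' : Plane × Plane) : Prop :=
  ∃ Φ : OpenPartialHomeomorph (Plane × Plane) (Plane × Plane),
    p ∈ Φ.source ∧ Φ p = p' ∧ Φ.source ⊆ g.domain ∧ Φ.target ⊆ g'.domain ∧
    ContDiffOn ℝ ∞ Φ Φ.source ∧ ContDiffOn ℝ ∞ Φ.symm Φ.target ∧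
    ∀ q ∈ Φ.source, ∀ v w : Plane × Plane,
      g'.form (Φ q) (fderiv ℝ Φ q v) (fderiv ℝ Φ q w) = g.form q v w

/-- The metrics are (locally) equivalent. -/
def Equivalent (g g' : AdaptedMetric) : Prop :=
  ∃ p ∈ g.domain, ∃ p' ∈ g'.domain, EquivalentAt g g' p p'

/-- An adapted coordinate transformation
`t̄ⁱ = φⁱ(t)`, `z̄ⁱ = α^i_j zʲ + ψⁱ(t)`, defined for `t` in an open set `V` and `z ∈ ℝ²`. -/
structure AdaptedTransformation (g g' : AdaptedMetric) where
  V : Set Plane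
  isOpen_V : IsOpen V
  V_subset : V ⊆ g.U
  φ : Plane → Plane
  ψ : Plane → Plane
  α : GL (Fin 2) ℝ
  smooth_φ : ContDiffOn ℝ ∞ φ V
  smooth_ψ : ContDiffOn ℝ ∞ ψ V
  mapsTo : Set.MapsTo φ V g'.U
  injOn : Set.InjOn φ V
  jacobian_ne : ∀ t ∈ V, (jac φ t).det ≠ 0

namespace AdaptedTransformation

variable {g g' : AdaptedMetric} (P : AdaptedTransformation g g')

/-- The transformation as a map of points `(t, z)`. -/
def toMap (q : Plane × Plane) : Plane × Plane :=
  (P.φ q.1, P.α.val.mulVec q.2 + P.ψ q.1)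

/-- `ε₁ = sgn J_φ`. -/
def ε₁ (t : Plane) : ℝ := Real.sign (jac P.φ t).det

/-- `ε₂ = sgn det α`. -/
def ε₂ : ℝ := Real.sign P.α.val.det

/-- The product of the `ℋ`-frame matrix of `g'` at `φ(t)` with the inverse one of `g` at `t`. -/
def meanQuotient (t : Plane) : Mat2 :=
  colMatrix (P.ε₁ t) (g'.mean (P.φ t)) (g'.meanPerp (P.φ t))
    * (colMatrix 1 (g.mean t) (g.meanPerp t))⁻¹

/-- (i) For some `a, b` the invariants `I_a, I_b` are functionally independent for both
metrics, and near every point `(t₀, φ(t₀))` the graph of `φ` is the solution set of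
`I_a[g](t) = I_a[g'](t̄)`, `I_b[g](t) = I_b[g'](t̄)`. -/
def CondI : Prop :=
  ∃ a b : Fin 6,
    FunctionallyIndependentOn (g.inv a) (g.inv b) P.V ∧
    FunctionallyIndependentOn (g'.inv a) (g'.inv b) (P.φ '' P.V) ∧
    ∀ t₀ ∈ P.V, ∀ᶠ x : Plane × Plane in 𝓝 (t₀, P.φ t₀),
      (g.inv a x.1 = g'.inv a x.2 ∧ g.inv b x.1 = g'.inv b x.2) ↔ x.2 = P.φ x.1

/-- (ii) The matrix built from the `𝒞`-frames is constant and equal to `α`. -/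
def CondII : Prop :=
  ∀ t ∈ P.V,
    P.ε₁ t • (colMatrix P.ε₂ (g'.curv (P.φ t)) (g'.curvPerp (P.φ t))
      * (colMatrix 1 (g.curv t) (g.curvPerp t))⁻¹) = P.α.val

/-- (iii) The Jacobian matrix of `φ` matches the `ℋ`-frames. -/
def CondIII : Prop :=
  ∀ t ∈ P.V, jac P.φ t = P.meanQuotient t

/-- The right-hand side of the first-order system for `ψ`. -/
def psiRHS (t : Plane) : Mat2 :=
  P.α.val * g.fUp t - g'.fUp (P.φ t) * P.meanQuotient t

/-- (iv) The system `∂ψⁱ/∂tʲ = psiRHS i j` is integrable (its compatibility conditions hold)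
and `ψ` solves it. -/
def CondIV : Prop :=
  (∀ t ∈ P.V, ∀ i, pd 1 (fun s => P.psiRHS s i 0) t = pd 0 (fun s => P.psiRHS s i 1) t) ∧
  ∀ t ∈ P.V, jac P.ψ t = P.psiRHS t

/-- (v) The transformation rules of the metric coefficients. -/
def CondV : Prop :=
  ∀ t ∈ P.V,
    (∀ i j, g.b t i j =
      (∑ m, ∑ n, g'.b (P.φ t) m n * jac P.φ t m i * jac P.φ t n j)
        + (∑ m, ∑ r, g'.f (P.φ t) m r *
            (jac P.φ t m i * jac P.ψ t r j + jac P.φ t m j * jac P.ψ t r i))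
        + ∑ r, ∑ s, g'.h (P.φ t) r s * jac P.ψ t r i * jac P.ψ t s j) ∧
    (∀ i k, g.f t i k =
      (∑ m, ∑ r, g'.f (P.φ t) m r * P.α.val r k * jac P.φ t m i)
        + ∑ r, ∑ s, g'.h (P.φ t) r s * P.α.val r k * jac P.ψ t s i) ∧
    (∀ k l, g.h t k l = ∑ r, ∑ s, g'.h (P.φ t) r s * P.α.val r k * P.α.val s l)

/-- All five conditions. -/
def Conditions : Prop :=
  P.CondI ∧ P.CondII ∧ P.CondIII ∧ P.CondIV ∧ P.CondV

end AdaptedTransformation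

end

noncomputable section

/-! ### Partial derivatives -/

/-! The transformation rules (v) alone carry the equivalence problem; (i)–(iv) are consequences of
them.

A local isometry pulls the Killing fields `∂/∂z̄ᵏ` back to Killing fields, which by hypothesis are
constant combinations of the `∂/∂zᵏ`. So on a ball its differential restricts to the leaves as one
constant invertible matrix `A`. Integrating along the leaves gives `Φ(t, z) = (φ(t), A z + ψ(t))`,
and comparing coefficients in the pullback identity gives (v). This is
`IsLocalIsometry.exists_adaptedTransformation`. Conversely, (v) says exactly that the transformation
pulls `g'` back to `g`, and the inverse function theorem makes it a local diffeomorphism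
(`AdaptedTransformation.equivalentAt`).

Given (v), every object built from the metric transforms tensorially: `g̃`, `σ`, `ρ`, `χ` and `γ`
through the Jacobian of `φ`, `h` through `α`, and `f_j^k` as a connection form with gauge term `dψ`.
Hence the six invariants agree (`inv_transform`), and the frames `(𝒞, 𝒞^⊥)` and `(ℋ, ℋ^⊥)` are
mapped to each other up to the signs `ε₁`, `ε₂`. The frames are bases because `ℓ_𝒞` and `C_ρ` do not
vanish, so `α` and the Jacobian are quotients of frame matrices, which is (ii) and (iii). Solving
the gauge law for `dψ` gives (iv), and two independent invariants determine `φ`, which is (i).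
`conditions_of_condV` collects these facts. -/

theorem pd_congr {F G : Plane → ℝ} {t : Plane} (h : F =ᶠ[𝓝 t] G) (i : Fin 2) :
    pd i F t = pd i G t := by
  simp only [pd, h.fderiv_eq]

theorem pd_add {F G : Plane → ℝ} {t : Plane} (hF : DifferentiableAt ℝ F t)
    (hG : DifferentiableAt ℝ G t) (i : Fin 2) :
    pd i (fun s => F s + G s) t = pd i F t + pd i G t := by
  simp [pd, fderiv_fun_add hF hG]

theorem pd_mul {F G : Plane → ℝ} {t : Plane} (hF : DifferentiableAt ℝ F t)
    (hG : DifferentiableAt ℝ G t) (i : Fin 2) :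
    pd i (fun s => F s * G s) t = pd i F t * G t + F t * pd i G t := by
  simp [pd, fderiv_fun_mul hF hG]; ring

theorem pd_const_mul {F : Plane → ℝ} {t : Plane} (hF : DifferentiableAt ℝ F t) (c : ℝ)
    (i : Fin 2) : pd i (fun s => c * F s) t = c * pd i F t := by
  simp [pd, fderiv_const_mul hF c]

theorem fderiv_eq_sum_pd {F : Plane → ℝ} (t v : Plane) :
    fderiv ℝ F t v = ∑ m, pd m F t * v m := by
  have hv : v = v 0 • (Pi.single 0 1 : Plane) + v 1 • (Pi.single 1 1 : Plane) := by
    ext i; fin_cases i <;> simp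
  conv_lhs => rw [hv]
  simp only [map_add, map_smul, smul_eq_mul, Fin.sum_univ_two, pd]
  ring

theorem fderiv_eq_jac_mulVec {φ : Plane → Plane} {t : Plane} (hφ : DifferentiableAt ℝ φ t)
    (v : Plane) : fderiv ℝ φ t v = (jac φ t).mulVec v := by
  ext i
  have h := fderiv_apply hφ i
  have h' : (fderiv ℝ φ t v) i = fderiv ℝ (fun s => φ s i) t v := by rw [h]; rfl
  rw [h', fderiv_eq_sum_pd]
  rfl

theorem pd_comp {F : Plane → ℝ} {φ : Plane → Plane} {t : Plane}
    (hF : DifferentiableAt ℝ F (φ t)) (hφ : DifferentiableAt ℝ φ t) (i : Fin 2) :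
    pd i (fun s => F (φ s)) t = ∑ m, pd m F (φ t) * jac φ t m i := by
  have h : fderiv ℝ (fun s => F (φ s)) t = (fderiv ℝ F (φ t)).comp (fderiv ℝ φ t) :=
    fderiv_comp t hF hφ
  rw [pd, h, ContinuousLinearMap.comp_apply, fderiv_eq_jac_mulVec hφ, fderiv_eq_sum_pd]
  simp

theorem contDiffOn_pd {F : Plane → ℝ} {U : Set Plane} (hU : IsOpen U)
    (hF : ContDiffOn ℝ ∞ F U) (i : Fin 2) : ContDiffOn ℝ ∞ (pd i F) U :=
  (hF.fderiv_of_isOpen hU (by simp)).clm_apply contDiffOn_const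

theorem pd_comm {F : Plane → ℝ} {U : Set Plane} (hU : IsOpen U) (hF : ContDiffOn ℝ ∞ F U)
    {t : Plane} (ht : t ∈ U) (i j : Fin 2) : pd i (pd j F) t = pd j (pd i F) t := by
  have hsymm : IsSymmSndFDerivAt ℝ F t :=
    (hF.contDiffAt (hU.mem_nhds ht)).isSymmSndFDerivAt
      (by simpa using WithTop.coe_le_coe.2 (le_top : (2 : ℕ∞) ≤ ⊤))
  have hd : DifferentiableAt ℝ (fderiv ℝ F) t :=
    ((hF.fderiv_of_isOpen hU (m := ∞) (by simp)).contDiffAt (hU.mem_nhds ht)).differentiableAt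
      (by simp)
  have key : ∀ a b : Fin 2, pd a (pd b F) t
      = fderiv ℝ (fderiv ℝ F) t (Pi.single a 1) (Pi.single b 1) := by
    intro a b
    change fderiv ℝ (fun s => fderiv ℝ F s (Pi.single b 1)) t (Pi.single a 1) = _
    rw [fderiv_clm_apply hd (differentiableAt_const _)]
    simp
  rw [key, key]
  exact hsymm _ _

theorem differentiableAt_of_contDiffOn {E G : Type*} [NormedAddCommGroup E] [NormedSpace ℝ E]
    [NormedAddCommGroup G] [NormedSpace ℝ G] {F : E → G} {U : Set E}
    (hF : ContDiffOn ℝ ∞ F U) (hU : IsOpen U) {t : E} (ht : t ∈ U) : DifferentiableAt ℝ F t :=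
  (hF.contDiffAt (hU.mem_nhds ht)).differentiableAt (by simp)

/-! ### Smoothness of the invariants -/

/-- Entries of the inverse of a smooth family of invertible matrices are smooth. -/
theorem contDiffOn_inv_entry {A : Plane → Mat2} {U : Set Plane}
    (hA : ∀ i j, ContDiffOn ℝ ∞ (fun t => A t i j) U) (hdet : ∀ t ∈ U, (A t).det ≠ 0)
    (i j : Fin 2) : ContDiffOn ℝ ∞ (fun t => (A t)⁻¹ i j) U := by
  have hd : ContDiffOn ℝ ∞ (fun t => ((A t).det)⁻¹) U := by
    refine ContDiffOn.inv ?_ hdet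
    simp only [Matrix.det_fin_two]
    exact ((hA 0 0).mul (hA 1 1)).sub ((hA 0 1).mul (hA 1 0))
  have hadj : ContDiffOn ℝ ∞ (fun t => (A t).adjugate i j) U := by
    simp only [Matrix.adjugate_fin_two]
    fin_cases i <;> fin_cases j
    · simpa using hA 1 1
    · simpa using (hA 0 1).neg
    · simpa using (hA 1 0).neg
    · simpa using hA 0 0
  refine (hd.mul hadj).congr fun t _ => ?_
  simp [Matrix.inv_def]

theorem contDiffOn_sqrt_abs {F : Plane → ℝ} {U : Set Plane} (hF : ContDiffOn ℝ ∞ F U)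
    (hne : ∀ t ∈ U, F t ≠ 0) : ContDiffOn ℝ ∞ (fun t => √|F t|) U :=
  fun t ht => ((contDiffAt_abs (hne t ht)).comp_contDiffWithinAt t (hF t ht)).sqrt
    (abs_ne_zero.2 (hne t ht))

namespace AdaptedMetric

variable (g : AdaptedMetric)

theorem orbit_eq (t : Plane) : g.orbit t = g.b t - g.f t * (g.h t)⁻¹ * (g.f t).transpose := by
  ext i j
  simp [orbit, Matrix.mul_apply, Fin.sum_univ_two]
  ring

theorem fUp_eq (t : Plane) : g.fUp t = (g.f t * (g.h t)⁻¹).transpose := by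
  ext i j
  simp [fUp, Matrix.mul_apply]

/-- `g̃` is the Schur complement of `h` in the full metric matrix, whose determinant is therefore
`det h · det g̃`. -/
theorem det_orbit_ne {t : Plane} (ht : t ∈ g.U) : (g.orbit t).det ≠ 0 := by
  have h := g.nondegenerate t ht
  have : Invertible (g.h t) :=
    Matrix.invertibleOfIsUnitDet _ (isUnit_iff_ne_zero.2 (g.leaves_nonnull t ht))
  rw [Matrix.det_fromBlocks₂₂, Matrix.invOf_eq_nonsing_inv, ← orbit_eq] at h
  exact right_ne_zero_of_mul h

theorem smooth_detH : ContDiffOn ℝ ∞ g.detH g.U := by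
  have : g.detH = fun t => g.h t 0 0 * g.h t 1 1 - g.h t 0 1 * g.h t 1 0 := by
    funext t; simp [detH, Matrix.det_fin_two]
  rw [this]
  exact ((g.smooth_h 0 0).mul (g.smooth_h 1 1)).sub ((g.smooth_h 0 1).mul (g.smooth_h 1 0))

theorem detH_ne {t : Plane} (ht : t ∈ g.U) : g.detH t ≠ 0 := g.leaves_nonnull t ht

theorem smooth_fUp (k j : Fin 2) : ContDiffOn ℝ ∞ (fun t => g.fUp t k j) g.U :=
  ContDiffOn.sum (s := Finset.univ) fun s _ =>
    (g.smooth_f j s).mul (contDiffOn_inv_entry g.smooth_h g.leaves_nonnull s k)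

theorem smooth_orbit (i j : Fin 2) : ContDiffOn ℝ ∞ (fun t => g.orbit t i j) g.U :=
  (g.smooth_b i j).sub <| ContDiffOn.sum fun k _ => ContDiffOn.sum fun l _ =>
    ((g.smooth_f i k).mul (g.smooth_f j l)).mul
      (contDiffOn_inv_entry g.smooth_h g.leaves_nonnull k l)

theorem smooth_det_orbit : ContDiffOn ℝ ∞ (fun t => (g.orbit t).det) g.U := by
  simp only [Matrix.det_fin_two]
  exact ((g.smooth_orbit 0 0).mul (g.smooth_orbit 1 1)).sub
    ((g.smooth_orbit 0 1).mul (g.smooth_orbit 1 0))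

theorem smooth_sqrtOrbit : ContDiffOn ℝ ∞ g.sqrtOrbit g.U :=
  contDiffOn_sqrt_abs g.smooth_det_orbit fun _ ht => g.det_orbit_ne ht

theorem sqrtOrbit_ne {t : Plane} (ht : t ∈ g.U) : g.sqrtOrbit t ≠ 0 :=
  (Real.sqrt_pos.2 (abs_pos.2 (g.det_orbit_ne ht))).ne'

theorem sqrt_detH_ne {t : Plane} (ht : t ∈ g.U) : √|g.detH t| ≠ 0 :=
  (Real.sqrt_pos.2 (abs_pos.2 (g.detH_ne ht))).ne'

theorem smooth_dh (k l i : Fin 2) : ContDiffOn ℝ ∞ (g.dh k l i) g.U :=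
  contDiffOn_pd g.isOpen_U (g.smooth_h k l) i

theorem smooth_sigma (i : Fin 2) : ContDiffOn ℝ ∞ (fun t => g.sigma t i) g.U :=
  (contDiffOn_pd g.isOpen_U g.smooth_detH i).div g.smooth_detH fun _ ht => g.detH_ne ht

theorem smooth_rho (i j : Fin 2) : ContDiffOn ℝ ∞ (fun t => g.rho t i j) g.U :=
  (g.smooth_sigma i).mul (g.smooth_sigma j)

theorem smooth_chi (i j : Fin 2) : ContDiffOn ℝ ∞ (fun t => g.chi t i j) g.U := by
  refine ContDiffOn.mul (contDiffOn_const.div (contDiffOn_const.mul g.smooth_detH)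
    fun t ht => mul_ne_zero two_ne_zero (g.detH_ne ht)) (ContDiffOn.add ?_ ?_) <;>
  exact ((g.smooth_dh _ _ _).mul (g.smooth_dh _ _ _)).sub
    ((g.smooth_dh _ _ _).mul (g.smooth_dh _ _ _))

theorem smooth_gamma (i j : Fin 2) : ContDiffOn ℝ ∞ (fun t => g.gamma t i j) g.U :=
  (g.smooth_chi i j).sub (contDiffOn_const.mul (g.smooth_rho i j))

theorem smooth_traceInv {μ : Plane → Mat2} (hμ : ∀ i j, ContDiffOn ℝ ∞ (fun t => μ t i j) g.U) :
    ContDiffOn ℝ ∞ (g.traceInv μ) g.U :=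
  ContDiffOn.sum fun i _ => ContDiffOn.sum fun j _ =>
    (hμ i j).mul (contDiffOn_inv_entry g.smooth_orbit (fun _ ht => g.det_orbit_ne ht) i j)

theorem smooth_detInv {μ : Plane → Mat2} (hμ : ∀ i j, ContDiffOn ℝ ∞ (fun t => μ t i j) g.U) :
    ContDiffOn ℝ ∞ (g.detInv μ) g.U := by
  refine ContDiffOn.div ?_ g.smooth_det_orbit fun _ ht => g.det_orbit_ne ht
  simp only [Matrix.det_fin_two]
  exact ((hμ 0 0).mul (hμ 1 1)).sub ((hμ 0 1).mul (hμ 1 0))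

theorem smooth_curv (k : Fin 2) : ContDiffOn ℝ ∞ (fun t => g.curv t k) g.U :=
  ((contDiffOn_pd g.isOpen_U (g.smooth_fUp k 0) 1).sub
    (contDiffOn_pd g.isOpen_U (g.smooth_fUp k 1) 0)).div g.smooth_sqrtOrbit
    fun _ ht => g.sqrtOrbit_ne ht

theorem smooth_ellC : ContDiffOn ℝ ∞ g.ellC g.U :=
  ContDiffOn.sum fun k _ => ContDiffOn.sum fun l _ =>
    ((g.smooth_h k l).mul (g.smooth_curv k)).mul (g.smooth_curv l)

theorem smooth_thetaI : ContDiffOn ℝ ∞ g.thetaI g.U := by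
  refine ContDiffOn.mul (contDiffOn_const.div
    ((contDiffOn_sqrt_abs g.smooth_detH fun _ ht => g.detH_ne ht).mul g.smooth_sqrtOrbit)
    fun t ht => mul_ne_zero (g.sqrt_detH_ne ht) (g.sqrtOrbit_ne ht)) ?_
  simp only [Matrix.det_fin_three, Matrix.of_apply, Matrix.cons_val]
  have d := g.smooth_dh
  have c := g.smooth_curv
  have c1 := (c 1).pow 2
  have c0 := (c 0).pow 2
  have c01 := ((c 0).mul (c 1)).neg
  exact ((((((((d 0 0 0).mul (d 0 1 1)).mul c0).sub (((d 0 0 0).mul (d 1 1 1)).mul c01)).sub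
    (((d 0 1 0).mul (d 0 0 1)).mul c0)).add (((d 0 1 0).mul (d 1 1 1)).mul c1)).add
    (((d 1 1 0).mul (d 0 0 1)).mul c01)).sub (((d 1 1 0).mul (d 0 1 1)).mul c1))

theorem smooth_inv (a : Fin 6) : ContDiffOn ℝ ∞ (g.inv a) g.U := by
  fin_cases a
  · exact g.smooth_traceInv g.smooth_rho
  · exact g.smooth_traceInv g.smooth_chi
  · exact g.smooth_detInv g.smooth_chi
  · exact g.smooth_detInv g.smooth_gamma
  · exact g.smooth_ellC
  · exact g.smooth_thetaI.pow 2

end AdaptedMetric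

/-! ### Behaviour under adapted transformations -/

theorem real_sign_eq_div_abs (x : ℝ) : Real.sign x = x / |x| := by
  rcases lt_trichotomy x 0 with h | h | h
  · rw [Real.sign_of_neg h, abs_of_neg h, div_neg, div_self h.ne]
  · simp [h]
  · rw [Real.sign_of_pos h, abs_of_pos h, div_self h.ne']

theorem real_sign_mul_self {x : ℝ} (h : x ≠ 0) : Real.sign x * Real.sign x = 1 := by
  rcases lt_or_gt_of_ne h with h | h
  · rw [Real.sign_of_neg h]; norm_num
  · rw [Real.sign_of_pos h]; norm_num

namespace AdaptedTransformation

variable {g g' : AdaptedMetric} {P : AdaptedTransformation g g'}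

theorem det_α_ne (P : AdaptedTransformation g g') : P.α.val.det ≠ 0 :=
  ((Matrix.isUnit_iff_isUnit_det _).1 P.α.isUnit).ne_zero

theorem differentiableAt_φ {t : Plane} (ht : t ∈ P.V) : DifferentiableAt ℝ P.φ t :=
  differentiableAt_of_contDiffOn P.smooth_φ P.isOpen_V ht

theorem differentiableAt_ψ {t : Plane} (ht : t ∈ P.V) : DifferentiableAt ℝ P.ψ t :=
  differentiableAt_of_contDiffOn P.smooth_ψ P.isOpen_V ht

theorem h_eq (hP : P.CondV) {t : Plane} (ht : t ∈ P.V) :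
    g.h t = P.α.val.transpose * g'.h (P.φ t) * P.α.val := by
  ext k l
  rw [(hP t ht).2.2 k l]
  simp [Matrix.mul_apply, Fin.sum_univ_two]
  ring

theorem f_eq (hP : P.CondV) {t : Plane} (ht : t ∈ P.V) :
    g.f t = ((jac P.φ t).transpose * g'.f (P.φ t)
      + (jac P.ψ t).transpose * g'.h (P.φ t)) * P.α.val := by
  have hs := (g'.symm_h _ (P.mapsTo ht)).apply 0 1
  ext i k
  rw [(hP t ht).2.1 i k]
  simp [Matrix.mul_apply, Fin.sum_univ_two, hs]
  ring

theorem b_eq (hP : P.CondV) {t : Plane} (ht : t ∈ P.V) :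
    g.b t = (jac P.φ t).transpose * g'.b (P.φ t) * jac P.φ t
      + (jac P.φ t).transpose * g'.f (P.φ t) * jac P.ψ t
      + (jac P.ψ t).transpose * (g'.f (P.φ t)).transpose * jac P.φ t
      + (jac P.ψ t).transpose * g'.h (P.φ t) * jac P.ψ t := by
  ext i j
  rw [(hP t ht).1 i j]
  simp [Matrix.mul_apply, Fin.sum_univ_two]
  ring

theorem f_mul_inv_h_eq (hP : P.CondV) {t : Plane} (ht : t ∈ P.V) :
    g.f t * (g.h t)⁻¹ = ((jac P.φ t).transpose * (g'.f (P.φ t) * (g'.h (P.φ t))⁻¹)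
      + (jac P.ψ t).transpose) * P.α.val.transpose⁻¹ := by
  have hα : IsUnit P.α.val.det := isUnit_iff_ne_zero.2 P.det_α_ne
  have hh : IsUnit (g'.h (P.φ t)).det :=
    isUnit_iff_ne_zero.2 (g'.leaves_nonnull _ (P.mapsTo ht))
  rw [f_eq hP ht, h_eq hP ht, Matrix.mul_inv_rev, Matrix.mul_inv_rev, Matrix.mul_assoc,
    Matrix.mul_nonsing_inv_cancel_left _ _ hα, ← Matrix.mul_assoc, Matrix.add_mul,
    Matrix.mul_nonsing_inv_cancel_right _ _ hh, Matrix.mul_assoc (jac P.φ t).transpose]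

/-- Passing to the Schur complement removes the leaf directions: all terms in `ψ` cancel, and so
does `α`. What remains is a symmetric form on the orbit space, pulled back by `φ`. -/
theorem orbit_transform (hP : P.CondV) {t : Plane} (ht : t ∈ P.V) :
    g.orbit t = (jac P.φ t).transpose * g'.orbit (P.φ t) * jac P.φ t := by
  have hα : IsUnit P.α.val.transpose.det := by
    rw [Matrix.det_transpose]; exact isUnit_iff_ne_zero.2 P.det_α_ne
  have hh : IsUnit (g'.h (P.φ t)).det :=
    isUnit_iff_ne_zero.2 (g'.leaves_nonnull _ (P.mapsTo ht))
  have hs : (g'.h (P.φ t)).transpose = g'.h (P.φ t) := g'.symm_h _ (P.mapsTo ht)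
  have hf : (g.f t).transpose = P.α.val.transpose * ((g'.f (P.φ t)).transpose * jac P.φ t
      + g'.h (P.φ t) * jac P.ψ t) := by
    rw [f_eq hP ht, Matrix.transpose_mul, Matrix.transpose_add, Matrix.transpose_mul,
      Matrix.transpose_mul, Matrix.transpose_transpose, Matrix.transpose_transpose, hs]
  have hc : (g'.h (P.φ t))⁻¹ * (g'.h (P.φ t) * jac P.ψ t) = jac P.ψ t :=
    Matrix.nonsing_inv_mul_cancel_left _ _ hh
  rw [g.orbit_eq, g'.orbit_eq, f_mul_inv_h_eq hP ht, hf, Matrix.mul_assoc _ _⁻¹,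
    Matrix.nonsing_inv_mul_cancel_left _ _ hα, b_eq hP ht]
  simp only [Matrix.add_mul, Matrix.mul_add, Matrix.mul_sub, Matrix.sub_mul, Matrix.mul_assoc, hc]
  abel

/-- The gauge law of a connection form. Solved for `jac P.ψ t`, it is the system in (iv). -/
theorem fUp_transform (hP : P.CondV) {t : Plane} (ht : t ∈ P.V) :
    P.α.val * g.fUp t = g'.fUp (P.φ t) * jac P.φ t + jac P.ψ t := by
  have hα : IsUnit P.α.val.det := isUnit_iff_ne_zero.2 P.det_α_ne
  rw [g.fUp_eq, g'.fUp_eq, f_mul_inv_h_eq hP ht, Matrix.transpose_mul, Matrix.transpose_add,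
    Matrix.transpose_nonsing_inv, Matrix.transpose_transpose,
    Matrix.mul_nonsing_inv_cancel_left _ _ hα, Matrix.transpose_mul,
    Matrix.transpose_transpose, Matrix.transpose_transpose]

theorem detH_transform (hP : P.CondV) {t : Plane} (ht : t ∈ P.V) :
    g.detH t = P.α.val.det ^ 2 * g'.detH (P.φ t) := by
  rw [AdaptedMetric.detH, h_eq hP ht, Matrix.det_mul, Matrix.det_mul, Matrix.det_transpose,
    AdaptedMetric.detH]
  ring

theorem sqrt_detH_transform (hP : P.CondV) {t : Plane} (ht : t ∈ P.V) :
    √|g.detH t| = |P.α.val.det| * √|g'.detH (P.φ t)| := by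
  rw [detH_transform hP ht, abs_mul, Real.sqrt_mul (abs_nonneg _), abs_sq, Real.sqrt_sq_eq_abs]

theorem det_orbit_transform (hP : P.CondV) {t : Plane} (ht : t ∈ P.V) :
    (g.orbit t).det = (jac P.φ t).det ^ 2 * (g'.orbit (P.φ t)).det := by
  rw [orbit_transform hP ht, Matrix.det_mul, Matrix.det_mul, Matrix.det_transpose]
  ring

theorem sqrtOrbit_transform (hP : P.CondV) {t : Plane} (ht : t ∈ P.V) :
    g.sqrtOrbit t = |(jac P.φ t).det| * g'.sqrtOrbit (P.φ t) := by
  rw [AdaptedMetric.sqrtOrbit, det_orbit_transform hP ht, abs_mul,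
    Real.sqrt_mul (abs_nonneg _), abs_sq, Real.sqrt_sq_eq_abs, AdaptedMetric.sqrtOrbit]

/-- Since `α` is constant, `dh` obeys the same law as `h`, with only a chain-rule factor added. -/
theorem dh_transform (hP : P.CondV) {t : Plane} (ht : t ∈ P.V) (k l i : Fin 2) :
    g.dh k l i t =
      ∑ r, ∑ s, (∑ m, g'.dh r s m (P.φ t) * jac P.φ t m i) * P.α.val r k * P.α.val s l := by
  have hd : ∀ r s, DifferentiableAt ℝ (fun t => g'.h (P.φ t) r s) t := fun r s =>
    DifferentiableAt.comp t (f := P.φ) (differentiableAt_of_contDiffOn (g'.smooth_h r s)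
      g'.isOpen_U (P.mapsTo ht)) (differentiableAt_φ ht)
  have hc : ∀ r s, pd i (fun t => g'.h (P.φ t) r s) t
      = ∑ m, g'.dh r s m (P.φ t) * jac P.φ t m i := fun r s =>
    pd_comp (F := fun x => g'.h x r s) (differentiableAt_of_contDiffOn (g'.smooth_h r s)
      g'.isOpen_U (P.mapsTo ht)) (differentiableAt_φ ht) i
  have he : (fun s => g.h s k l) =ᶠ[𝓝 t] fun x =>
      (P.α.val 0 k * P.α.val 0 l * g'.h (P.φ x) 0 0 + P.α.val 0 k * P.α.val 1 l * g'.h (P.φ x) 0 1)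
      + (P.α.val 1 k * P.α.val 0 l * g'.h (P.φ x) 1 0
        + P.α.val 1 k * P.α.val 1 l * g'.h (P.φ x) 1 1) := by
    filter_upwards [P.isOpen_V.mem_nhds ht] with x hx
    rw [(hP x hx).2.2 k l]
    simp only [Fin.sum_univ_two]
    ring
  have hm : ∀ (c : ℝ) r s, DifferentiableAt ℝ (fun t => c * g'.h (P.φ t) r s) t :=
    fun c r s => (hd r s).const_mul c
  rw [AdaptedMetric.dh, pd_congr he,
    pd_add ((hm _ _ _).fun_add (hm _ _ _)) ((hm _ _ _).fun_add (hm _ _ _)),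
    pd_add (hm _ _ _) (hm _ _ _), pd_add (hm _ _ _) (hm _ _ _)]
  simp only [pd_const_mul (hd _ _), hc, Fin.sum_univ_two]
  ring

theorem pd_detH_transform (hP : P.CondV) {t : Plane} (ht : t ∈ P.V) (i : Fin 2) :
    pd i g.detH t
      = P.α.val.det ^ 2 * ∑ m, pd m g'.detH (P.φ t) * jac P.φ t m i := by
  have hd' := differentiableAt_of_contDiffOn g'.smooth_detH g'.isOpen_U (P.mapsTo ht)
  have he : g.detH =ᶠ[𝓝 t] fun x => P.α.val.det ^ 2 * g'.detH (P.φ x) := by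
    filter_upwards [P.isOpen_V.mem_nhds ht] with x hx using detH_transform hP hx
  rw [pd_congr he, pd_const_mul (DifferentiableAt.fun_comp' t hd' (differentiableAt_φ ht)),
    pd_comp hd' (differentiableAt_φ ht)]

theorem sigma_transform (hP : P.CondV) {t : Plane} (ht : t ∈ P.V) (i : Fin 2) :
    g.sigma t i = ∑ m, g'.sigma (P.φ t) m * jac P.φ t m i := by
  have := P.det_α_ne
  have := g'.detH_ne (P.mapsTo ht)
  simp only [AdaptedMetric.sigma, pd_detH_transform hP ht, detH_transform hP ht,
    Fin.sum_univ_two]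
  field_simp

theorem rho_transform (hP : P.CondV) {t : Plane} (ht : t ∈ P.V) :
    g.rho t = (jac P.φ t).transpose * g'.rho (P.φ t) * jac P.φ t := by
  ext i j
  simp [AdaptedMetric.rho, sigma_transform hP ht, Matrix.mul_apply, Fin.sum_univ_two]
  ring

/-- `dh₁₁ dh₂₂ - dh₁₂²` is the determinant of the matrix of 1-forms `dh`, so it acquires the factor
`(det α)²`, which the same factor of `det h` cancels. -/
theorem chi_transform (hP : P.CondV) {t : Plane} (ht : t ∈ P.V) :
    g.chi t = (jac P.φ t).transpose * g'.chi (P.φ t) * jac P.φ t := by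
  have h1 := P.det_α_ne
  have h2 := g'.detH_ne (P.mapsTo ht)
  ext i j
  simp only [AdaptedMetric.chi, dh_transform hP ht, detH_transform hP ht, Matrix.mul_apply,
    Matrix.transpose_apply, Matrix.of_apply, Fin.sum_univ_two]
  field_simp
  rw [Matrix.det_fin_two]
  ring

theorem gamma_transform (hP : P.CondV) {t : Plane} (ht : t ∈ P.V) :
    g.gamma t = (jac P.φ t).transpose * g'.gamma (P.φ t) * jac P.φ t := by
  rw [AdaptedMetric.gamma, chi_transform hP ht, rho_transform hP ht, AdaptedMetric.gamma]
  simp [Matrix.mul_sub, Matrix.sub_mul]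

theorem traceInv_eq_trace (g : AdaptedMetric) (μ : Plane → Mat2) (t : Plane) :
    g.traceInv μ t = (μ t * (g.orbit t)⁻¹.transpose).trace := by
  simp [AdaptedMetric.traceInv, Matrix.trace, Matrix.mul_apply]

theorem traceInv_transform (hP : P.CondV) {μ μ' : Plane → Mat2} {t : Plane} (ht : t ∈ P.V)
    (hμ : μ t = (jac P.φ t).transpose * μ' (P.φ t) * jac P.φ t) :
    g.traceInv μ t = g'.traceInv μ' (P.φ t) := by
  have hJ : IsUnit (jac P.φ t).det := isUnit_iff_ne_zero.2 (P.jacobian_ne t ht)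
  have hJ' : IsUnit (jac P.φ t).transpose.det := by rwa [Matrix.det_transpose]
  rw [traceInv_eq_trace, traceInv_eq_trace, hμ, orbit_transform hP ht, Matrix.mul_inv_rev,
    Matrix.mul_inv_rev, Matrix.transpose_mul, Matrix.transpose_mul, Matrix.mul_assoc,
    Matrix.transpose_nonsing_inv, Matrix.transpose_transpose, Matrix.transpose_nonsing_inv,
    Matrix.mul_assoc _⁻¹, Matrix.mul_nonsing_inv_cancel_left _ _ hJ, ← Matrix.mul_assoc,
    Matrix.trace_mul_comm, ← Matrix.mul_assoc, ← Matrix.mul_assoc,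
    Matrix.transpose_nonsing_inv, Matrix.nonsing_inv_mul _ hJ', Matrix.one_mul]

theorem detInv_transform (hP : P.CondV) {μ μ' : Plane → Mat2} {t : Plane} (ht : t ∈ P.V)
    (hμ : μ t = (jac P.φ t).transpose * μ' (P.φ t) * jac P.φ t) :
    g.detInv μ t = g'.detInv μ' (P.φ t) := by
  have hJ := P.jacobian_ne t ht
  rw [AdaptedMetric.detInv, AdaptedMetric.detInv, hμ, det_orbit_transform hP ht,
    Matrix.det_mul, Matrix.det_mul, Matrix.det_transpose]
  have := g'.det_orbit_ne (P.mapsTo ht)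
  field_simp

theorem ε₁_mul_self {t : Plane} (ht : t ∈ P.V) : P.ε₁ t * P.ε₁ t = 1 :=
  real_sign_mul_self (P.jacobian_ne t ht)

theorem pd_jac_comm {χ : Plane → Plane} {V : Set Plane} (hV : IsOpen V)
    (hχ : ContDiffOn ℝ ∞ χ V) {t : Plane} (ht : t ∈ V) (k : Fin 2) :
    pd 1 (fun s => jac χ s k 0) t = pd 0 (fun s => jac χ s k 1) t :=
  pd_comm hV (contDiffOn_pi.1 hχ k) ht 1 0

/-- The curvature of the connection form. In the curl of the gauge law the second derivatives of `φ`
and `ψ` cancel by symmetry, and antisymmetrizing the two chain-rule factors leaves the Jacobian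
determinant. -/
theorem curl_fUp_transform (hP : P.CondV) {t : Plane} (ht : t ∈ P.V) (k : Fin 2) :
    (∑ l, P.α.val k l * (pd 1 (fun s => g.fUp s l 0) t - pd 0 (fun s => g.fUp s l 1) t))
      = (jac P.φ t).det * (pd 1 (fun s => g'.fUp s k 0) (P.φ t)
          - pd 0 (fun s => g'.fUp s k 1) (P.φ t)) := by
  have hφ := differentiableAt_φ ht
  have hd : ∀ l j, DifferentiableAt ℝ (fun s => g.fUp s l j) t := fun l j =>
    differentiableAt_of_contDiffOn (g.smooth_fUp l j) g.isOpen_U (P.V_subset ht)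
  have hd' : ∀ l j, DifferentiableAt ℝ (fun s => g'.fUp s l j) (P.φ t) := fun l j =>
    differentiableAt_of_contDiffOn (g'.smooth_fUp l j) g'.isOpen_U (P.mapsTo ht)
  have hdc : ∀ l j, DifferentiableAt ℝ (fun s => g'.fUp (P.φ s) l j) t := fun l j =>
    DifferentiableAt.comp t (f := P.φ) (hd' l j) hφ
  have hJ : ∀ m j, DifferentiableAt ℝ (fun s => jac P.φ s m j) t := fun m j =>
    differentiableAt_of_contDiffOn
      (contDiffOn_pd P.isOpen_V (contDiffOn_pi.1 P.smooth_φ m) j) P.isOpen_V ht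
  have hΨ : ∀ m j, DifferentiableAt ℝ (fun s => jac P.ψ s m j) t := fun m j =>
    differentiableAt_of_contDiffOn
      (contDiffOn_pd P.isOpen_V (contDiffOn_pi.1 P.smooth_ψ m) j) P.isOpen_V ht
  have key : ∀ i j, (∑ l, P.α.val k l * pd i (fun s => g.fUp s l j) t)
      = (∑ m, ((∑ n, pd n (fun s => g'.fUp s k m) (P.φ t) * jac P.φ t n i) * jac P.φ t m j
          + g'.fUp (P.φ t) k m * pd i (fun s => jac P.φ s m j) t))
        + pd i (fun s => jac P.ψ s k j) t := by
    intro i j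
    have he : (fun s => P.α.val k 0 * g.fUp s 0 j + P.α.val k 1 * g.fUp s 1 j) =ᶠ[𝓝 t]
        fun s => (g'.fUp (P.φ s) k 0 * jac P.φ s 0 j + g'.fUp (P.φ s) k 1 * jac P.φ s 1 j)
          + jac P.ψ s k j := by
      filter_upwards [P.isOpen_V.mem_nhds ht] with x hx
      have := congrFun (congrFun (fUp_transform hP hx) k) j
      simpa [Matrix.mul_apply, Fin.sum_univ_two] using this
    have h := pd_congr he i
    rw [pd_add ((hd _ _).const_mul _) ((hd _ _).const_mul _), pd_const_mul (hd _ _),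
      pd_const_mul (hd _ _),
      pd_add (((hdc _ _).fun_mul (hJ _ _)).fun_add ((hdc _ _).fun_mul (hJ _ _))) (hΨ _ _),
      pd_add ((hdc _ _).fun_mul (hJ _ _)) ((hdc _ _).fun_mul (hJ _ _)),
      pd_mul (hdc _ _) (hJ _ _), pd_mul (hdc _ _) (hJ _ _),
      pd_comp (F := fun x => g'.fUp x k 0) (hd' _ _) hφ,
      pd_comp (F := fun x => g'.fUp x k 1) (hd' _ _) hφ] at h
    simpa [Fin.sum_univ_two] using h
  have h10 := key 1 0
  have h01 := key 0 1
  have sφ := pd_jac_comm P.isOpen_V P.smooth_φ ht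
  have sψ := pd_jac_comm P.isOpen_V P.smooth_ψ ht k
  simp only [Fin.sum_univ_two, sφ, sψ] at h10 h01 ⊢
  rw [Matrix.det_fin_two]
  linear_combination h10 - h01

/-- The curl scales by `J_φ` and `√|det g̃|` by `|J_φ|`, so only the sign of `J_φ` survives. -/
theorem curv_transform (hP : P.CondV) {t : Plane} (ht : t ∈ P.V) :
    P.α.val.mulVec (g.curv t) = P.ε₁ t • g'.curv (P.φ t) := by
  ext k
  have h := curl_fUp_transform hP ht k
  have h1 := g'.sqrtOrbit_ne (P.mapsTo ht)
  have h2 : |(jac P.φ t).det| ≠ 0 := abs_ne_zero.2 (P.jacobian_ne t ht)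
  simp only [Matrix.mulVec, dotProduct, AdaptedMetric.curv, Pi.smul_apply, smul_eq_mul, ε₁,
    real_sign_eq_div_abs, sqrtOrbit_transform hP ht, ← mul_div_assoc, ← Finset.sum_div, h]
  field_simp

/-- The operation `⊥` uses the area form `√|det h|` of the leaves, which `α` preserves up to the
sign of `det α`; this is the origin of `ε₂`. -/
theorem curvPerp_transform (hP : P.CondV) {t : Plane} (ht : t ∈ P.V) :
    P.α.val.mulVec (g.curvPerp t) = (P.ε₁ t * P.ε₂) • g'.curvPerp (P.φ t) := by
  have h1 := g'.sqrt_detH_ne (P.mapsTo ht)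
  have h2 : |P.α.val.det| ≠ 0 := abs_ne_zero.2 P.det_α_ne
  have hc0 := congrFun (curv_transform hP ht) 0
  have hc1 := congrFun (curv_transform hP ht) 1
  have hdet := Matrix.det_fin_two P.α.val
  simp only [Matrix.mulVec, dotProduct, Fin.sum_univ_two, Pi.smul_apply, smul_eq_mul] at hc0 hc1
  ext k
  fin_cases k <;>
  · simp only [Matrix.mulVec, dotProduct, AdaptedMetric.curvPerp, Pi.smul_apply, smul_eq_mul, ε₂,
      real_sign_eq_div_abs, sqrt_detH_transform hP ht, h_eq hP ht, Matrix.mul_apply,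
      Matrix.transpose_apply, Fin.sum_univ_two, Fin.zero_eta, Fin.mk_one, Fin.isValue,
      Matrix.cons_val_zero, Matrix.cons_val_one]
    field_simp
    rw [hdet]
    -- The two alternatives serve the components `k = 0` and `k = 1`, which lower the index of `𝒞`
    -- by different columns of `h`.
    first
    | linear_combination (P.α.val 0 0 * P.α.val 1 1 - P.α.val 0 1 * P.α.val 1 0) *
        (g'.h (P.φ t) 0 1 * hc0 + g'.h (P.φ t) 1 1 * hc1)
    | linear_combination -(P.α.val 0 0 * P.α.val 1 1 - P.α.val 0 1 * P.α.val 1 0) *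
        (g'.h (P.φ t) 0 0 * hc0 + g'.h (P.φ t) 1 0 * hc1)

theorem mean_eq (g : AdaptedMetric) (t : Plane) :
    g.mean t = (-(1 / 2) : ℝ) • (g.orbit t)⁻¹.mulVec (g.sigma t) := by
  ext i
  simp only [AdaptedMetric.mean, AdaptedMetric.sigma, Matrix.mulVec, dotProduct, Pi.smul_apply,
    smul_eq_mul]

theorem mean_transform (hP : P.CondV) {t : Plane} (ht : t ∈ P.V) :
    (jac P.φ t).mulVec (g.mean t) = g'.mean (P.φ t) := by
  have hJ : IsUnit (jac P.φ t).det := isUnit_iff_ne_zero.2 (P.jacobian_ne t ht)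
  have hJ' : IsUnit (jac P.φ t).transpose.det := by rwa [Matrix.det_transpose]
  have hs : g.sigma t = (jac P.φ t).transpose.mulVec (g'.sigma (P.φ t)) := by
    ext i
    simp [sigma_transform hP ht, Matrix.mulVec, dotProduct, mul_comm]
  rw [mean_eq, mean_eq, hs, orbit_transform hP ht, Matrix.mul_inv_rev, Matrix.mul_inv_rev,
    Matrix.mulVec_smul, Matrix.mulVec_mulVec, Matrix.mulVec_mulVec, Matrix.mul_assoc,
    Matrix.mul_assoc _⁻¹, Matrix.mul_nonsing_inv_cancel_left _ _ hJ,
    Matrix.nonsing_inv_mul_cancel_right _ _ hJ']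

/-- The orthogonal complement on the orbit space uses the area form of `g̃`, preserved by `φ` up to
the sign of its Jacobian determinant. -/
theorem meanPerp_transform (hP : P.CondV) {t : Plane} (ht : t ∈ P.V) :
    (jac P.φ t).mulVec (g.meanPerp t) = P.ε₁ t • g'.meanPerp (P.φ t) := by
  have h1 := g'.sqrtOrbit_ne (P.mapsTo ht)
  have h2 : |(jac P.φ t).det| ≠ 0 := abs_ne_zero.2 (P.jacobian_ne t ht)
  have h3 := P.det_α_ne
  have h4 := g'.detH_ne (P.mapsTo ht)
  have hdet := Matrix.det_fin_two (jac P.φ t)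
  ext k
  fin_cases k <;>
  · simp only [Matrix.mulVec, dotProduct, AdaptedMetric.meanPerp, Pi.smul_apply, smul_eq_mul, ε₁,
      real_sign_eq_div_abs, sqrtOrbit_transform hP ht, pd_detH_transform hP ht,
      detH_transform hP ht, Fin.sum_univ_two, Fin.zero_eta, Fin.mk_one, Fin.isValue,
      Matrix.cons_val_zero, Matrix.cons_val_one]
    field_simp
    rw [hdet]
    ring

end AdaptedTransformation

/-! ### Local inverses -/

theorem exists_continuousLinearEquiv {E : Type*} [NormedAddCommGroup E] [NormedSpace ℝ E]
    [FiniteDimensional ℝ E] {L : E →L[ℝ] E} (hL : Function.Injective L) :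
    ∃ e : E ≃L[ℝ] E, (e : E →L[ℝ] E) = L :=
  ⟨(LinearEquiv.ofInjectiveEndo L.toLinearMap hL).toContinuousLinearEquiv, by ext; rfl⟩

theorem exists_openPartialHomeomorph {E : Type*} [NormedAddCommGroup E] [NormedSpace ℝ E]
    [FiniteDimensional ℝ E] {f : E → E} {a : E} (hf : ContDiffAt ℝ ∞ f a)
    (hinj : Function.Injective (fderiv ℝ f a)) :
    ∃ e : OpenPartialHomeomorph E E, a ∈ e.source ∧ ⇑e = f := by
  have := FiniteDimensional.complete ℝ E
  obtain ⟨L, hL⟩ := exists_continuousLinearEquiv hinj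
  have hf' : HasFDerivAt f (L : E →L[ℝ] E) a := by
    rw [hL]
    exact (hf.differentiableAt (by simp)).hasFDerivAt
  exact ⟨hf.toOpenPartialHomeomorph f hf' (by simp),
    hf.mem_toOpenPartialHomeomorph_source hf' (by simp), rfl⟩

theorem mulVec_injective_of_det_ne {A : Mat2} (hA : A.det ≠ 0) : Function.Injective A.mulVec :=
  Matrix.mulVec_injective_of_isUnit ((Matrix.isUnit_iff_isUnit_det A).2 (isUnit_iff_ne_zero.2 hA))

theorem fderiv_injective_of_jac {φ : Plane → Plane} {t : Plane} (hφ : DifferentiableAt ℝ φ t)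
    (hJ : (jac φ t).det ≠ 0) : Function.Injective (fderiv ℝ φ t) := by
  intro v w h
  rw [fderiv_eq_jac_mulVec hφ, fderiv_eq_jac_mulVec hφ] at h
  exact mulVec_injective_of_det_ne hJ h

/-- Functionally independent smooth functions are jointly locally injective. -/
theorem exists_mem_nhds_injOn {F G : Plane → ℝ} {t : Plane} (hF : ContDiffAt ℝ ∞ F t)
    (hG : ContDiffAt ℝ ∞ G t) (h : pd 0 F t * pd 1 G t - pd 1 F t * pd 0 G t ≠ 0) :
    ∃ N ∈ 𝓝 t, ∀ x ∈ N, ∀ y ∈ N, F x = F y → G x = G y → x = y := by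
  have hs : ContDiffAt ℝ ∞ (fun x => (![F x, G x] : Plane)) t := by
    refine contDiffAt_pi.2 fun i => ?_
    fin_cases i
    exacts [hF, hG]
  obtain ⟨e, he, hfe⟩ := exists_openPartialHomeomorph hs
    (fderiv_injective_of_jac (hs.differentiableAt (by simp))
      (by simpa [jac, Matrix.det_fin_two] using h))
  refine ⟨e.source, e.open_source.mem_nhds he, fun x hx y hy h1 h2 => e.injOn hx hy ?_⟩
  simp only [hfe, h1, h2]

/-! ### Nondegeneracy of the two frames -/

namespace AdaptedMetric

variable (g : AdaptedMetric)

theorem dh_symm {t : Plane} (ht : t ∈ g.U) (i : Fin 2) : g.dh 1 0 i t = g.dh 0 1 i t := by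
  refine pd_congr ?_ i
  filter_upwards [g.isOpen_U.mem_nhds ht] with x hx using (g.symm_h x hx).apply 0 1

/-- The frame `(𝒞, 𝒞^⊥)` is nondegenerate where `ℓ_𝒞 ≠ 0`. -/
theorem det_curv_frame_ne {t : Plane} (ht : t ∈ g.U) (h : g.ellC t ≠ 0) :
    (colMatrix 1 (g.curv t) (g.curvPerp t)).det ≠ 0 := by
  have h1 := g.sqrt_detH_ne ht
  have : (colMatrix 1 (g.curv t) (g.curvPerp t)).det = -(g.ellC t / √|g.detH t|) := by
    simp [colMatrix, curvPerp, ellC, Matrix.det_fin_two, Fin.sum_univ_two]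
    field_simp
    ring
  rw [this]
  exact neg_ne_zero.2 (div_ne_zero h h1)

/-- The frame `(ℋ, ℋ^⊥)` is nondegenerate where `C_ρ ≠ 0`. -/
theorem det_mean_frame_ne {t : Plane} (ht : t ∈ g.U) (h : g.Crho t ≠ 0) :
    (colMatrix 1 (g.mean t) (g.meanPerp t)).det ≠ 0 := by
  have h1 := g.sqrtOrbit_ne ht
  have h2 := g.detH_ne ht
  have : (colMatrix 1 (g.mean t) (g.meanPerp t)).det = -(g.Crho t / (4 * g.sqrtOrbit t)) := by
    simp [colMatrix, meanPerp, mean, Crho, traceInv, rho, sigma, Matrix.det_fin_two,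
      Fin.sum_univ_two]
    field_simp
    ring
  rw [this]
  exact neg_ne_zero.2 (div_ne_zero h (mul_ne_zero four_ne_zero h1))

end AdaptedMetric

theorem mul_colMatrix (A : Mat2) (ε : ℝ) (X Y : Plane) :
    A * colMatrix ε X Y = colMatrix ε (A.mulVec X) (A.mulVec Y) := by
  ext i j
  fin_cases i <;> fin_cases j <;>
    simp [colMatrix, Matrix.mul_apply, Matrix.mulVec, dotProduct, Fin.sum_univ_two]
  all_goals ring

/-! ### Invariance of the six scalars, and conditions (i)–(iv) from the transformation rules -/

namespace AdaptedTransformation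

variable {g g' : AdaptedMetric} {P : AdaptedTransformation g g'}

theorem ellC_transform (hP : P.CondV) {t : Plane} (ht : t ∈ P.V) :
    g.ellC t = g'.ellC (P.φ t) := by
  have hε := ε₁_mul_self ht
  have hc0 := congrFun (curv_transform hP ht) 0
  have hc1 := congrFun (curv_transform hP ht) 1
  simp only [Matrix.mulVec, dotProduct, Fin.sum_univ_two, Pi.smul_apply, smul_eq_mul] at hc0 hc1
  -- Inserting `ε₁² = 1` turns products of barred components into products of components of `α 𝒞`;
  -- the sign drops out because `ℓ_𝒞` is quadratic in `𝒞`.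
  have e : ∀ a b : ℝ, a * b = (P.ε₁ t * a) * (P.ε₁ t * b) := fun a b => by
    linear_combination (-(a * b)) * hε
  simp only [AdaptedMetric.ellC, h_eq hP ht, Matrix.mul_apply, Matrix.transpose_apply,
    Fin.sum_univ_two, mul_assoc (g'.h _ _ _)]
  rw [e (g'.curv (P.φ t) 0), e (g'.curv (P.φ t) 0), e (g'.curv (P.φ t) 1),
    e (g'.curv (P.φ t) 1), ← hc0, ← hc1]
  ring

theorem thetaI_sq_transform (hP : P.CondV) {t : Plane} (ht : t ∈ P.V) :
    g.thetaI t ^ 2 = g'.thetaI (P.φ t) ^ 2 := by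
  have h1 := g'.sqrtOrbit_ne (P.mapsTo ht)
  have h2 := P.jacobian_ne t ht
  have h3 := P.det_α_ne
  have h4 := g'.sqrt_detH_ne (P.mapsTo ht)
  have hε := ε₁_mul_self ht
  have hc0 := congrFun (curv_transform hP ht) 0
  have hc1 := congrFun (curv_transform hP ht) 1
  simp only [Matrix.mulVec, dotProduct, Fin.sum_univ_two, Pi.smul_apply, smul_eq_mul] at hc0 hc1
  -- The third row holds the coefficients of the quadratic form `x ↦ (𝒞² x¹ - 𝒞¹ x²)²`, which picks
  -- up `(det α)²` under pullback, while substituting `α` in all three rows contributes `(det α)³`.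
  -- One factor `det α` is left, and the two derivative rows give `J_φ`. The prefactor of `Θ_I`
  -- cancels their absolute values, so `Θ_I` is invariant up to sign.
  have key : Matrix.det !![g.dh 0 0 0 t, g.dh 0 1 0 t, g.dh 1 1 0 t;
                  g.dh 0 0 1 t, g.dh 0 1 1 t, g.dh 1 1 1 t;
                  g.curv t 1 ^ 2, -(g.curv t 0 * g.curv t 1), g.curv t 0 ^ 2]
      = (jac P.φ t).det * P.α.val.det *
        Matrix.det !![g'.dh 0 0 0 (P.φ t), g'.dh 0 1 0 (P.φ t), g'.dh 1 1 0 (P.φ t);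
                  g'.dh 0 0 1 (P.φ t), g'.dh 0 1 1 (P.φ t), g'.dh 1 1 1 (P.φ t);
                  g'.curv (P.φ t) 1 ^ 2, -(g'.curv (P.φ t) 0 * g'.curv (P.φ t) 1),
                  g'.curv (P.φ t) 0 ^ 2] := by
    have e : ∀ a b : ℝ, a * b = (P.ε₁ t * a) * (P.ε₁ t * b) := fun a b => by
      linear_combination (-(a * b)) * hε
    simp only [sq]
    rw [e (g'.curv (P.φ t) 0), e (g'.curv (P.φ t) 0), e (g'.curv (P.φ t) 1), ← hc0, ← hc1]
    simp only [dh_transform hP ht, Matrix.det_fin_three, Matrix.det_fin_two, Fin.sum_univ_two,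
      g'.dh_symm (P.mapsTo ht), Matrix.of_apply, Matrix.cons_val]
    ring
  rw [AdaptedMetric.thetaI, AdaptedMetric.thetaI, key, sqrt_detH_transform hP ht,
    sqrtOrbit_transform hP ht]
  simp only [mul_pow, div_pow, sq_abs, one_pow]
  field_simp

theorem inv_transform (hP : P.CondV) (a : Fin 6) {t : Plane} (ht : t ∈ P.V) :
    g.inv a t = g'.inv a (P.φ t) := by
  fin_cases a
  · exact traceInv_transform hP ht (rho_transform hP ht)
  · exact traceInv_transform hP ht (chi_transform hP ht)
  · exact detInv_transform hP ht (chi_transform hP ht)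
  · exact detInv_transform hP ht (gamma_transform hP ht)
  · exact ellC_transform hP ht
  · exact thetaI_sq_transform hP ht

theorem condII_of_condV (hP : P.CondV) (hgen : ∀ t ∈ g.U, g.ellC t ≠ 0) : P.CondII := by
  intro t ht
  have hu : IsUnit (colMatrix 1 (g.curv t) (g.curvPerp t)).det :=
    isUnit_iff_ne_zero.2 (g.det_curv_frame_ne (P.V_subset ht) (hgen t (P.V_subset ht)))
  have h : P.ε₁ t • colMatrix P.ε₂ (g'.curv (P.φ t)) (g'.curvPerp (P.φ t))
      = P.α.val * colMatrix 1 (g.curv t) (g.curvPerp t) := by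
    rw [mul_colMatrix, curv_transform hP ht, curvPerp_transform hP ht]
    ext i j
    fin_cases i <;> fin_cases j <;> simp [colMatrix, mul_assoc]
  rw [← Matrix.smul_mul, h, Matrix.mul_nonsing_inv_cancel_right _ _ hu]

theorem condIII_of_condV (hP : P.CondV) (hgen : ∀ t ∈ g.U, g.Crho t ≠ 0) : P.CondIII := by
  intro t ht
  have hu : IsUnit (colMatrix 1 (g.mean t) (g.meanPerp t)).det :=
    isUnit_iff_ne_zero.2 (g.det_mean_frame_ne (P.V_subset ht) (hgen t (P.V_subset ht)))
  have h : colMatrix (P.ε₁ t) (g'.mean (P.φ t)) (g'.meanPerp (P.φ t))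
      = jac P.φ t * colMatrix 1 (g.mean t) (g.meanPerp t) := by
    rw [mul_colMatrix, mean_transform hP ht, meanPerp_transform hP ht]
    ext i j
    fin_cases i <;> fin_cases j <;> simp [colMatrix]
  rw [meanQuotient, h, Matrix.mul_nonsing_inv_cancel_right _ _ hu]

/-- By (iii) the frame quotient is the Jacobian of `φ`, so the gauge law identifies the right-hand
side with `jac P.ψ`. Integrability is then the equality of mixed partials of `ψ`. -/
theorem condIV_of_condV (hP : P.CondV) (hgen : ∀ t ∈ g.U, g.Crho t ≠ 0) : P.CondIV := by
  have h : ∀ t ∈ P.V, jac P.ψ t = P.psiRHS t := by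
    intro t ht
    rw [psiRHS, fUp_transform hP ht, ← condIII_of_condV hP hgen t ht, add_sub_cancel_left]
  refine ⟨fun t ht i => ?_, h⟩
  have he : ∀ j, (fun s => P.psiRHS s i j) =ᶠ[𝓝 t] fun s => jac P.ψ s i j := fun j => by
    filter_upwards [P.isOpen_V.mem_nhds ht] with x hx
    rw [h x hx]
  rw [pd_congr (he 0), pd_congr (he 1)]
  exact pd_jac_comm P.isOpen_V P.smooth_ψ ht i

theorem functionallyIndependentOn_image (hP : P.CondV) {a b : Fin 6}
    (hab : FunctionallyIndependentOn (g.inv a) (g.inv b) P.V) :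
    FunctionallyIndependentOn (g'.inv a) (g'.inv b) (P.φ '' P.V) := by
  rintro _ ⟨t, ht, rfl⟩ h0
  refine hab t ht ?_
  have hc : ∀ c i, pd i (g.inv c) t = ∑ m, pd m (g'.inv c) (P.φ t) * jac P.φ t m i := by
    intro c i
    have he : g.inv c =ᶠ[𝓝 t] fun x => g'.inv c (P.φ x) := by
      filter_upwards [P.isOpen_V.mem_nhds ht] with x hx using inv_transform hP c hx
    rw [pd_congr he, pd_comp (differentiableAt_of_contDiffOn (g'.smooth_inv c) g'.isOpen_U
      (P.mapsTo ht)) (differentiableAt_φ ht)]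
  simp only [hc, Fin.sum_univ_two]
  -- By the chain rule the wedge of the unbarred invariants is `J_φ` times that of the barred ones,
  -- which `h0` assumes to vanish.
  linear_combination (jac P.φ t 0 0 * jac P.φ t 1 1 - jac P.φ t 0 1 * jac P.φ t 1 0) * h0

theorem condI_of_condV (hP : P.CondV)
    (hind : ∃ a b : Fin 6, FunctionallyIndependentOn (g.inv a) (g.inv b) g.U) : P.CondI := by
  obtain ⟨a, b, hab⟩ := hind
  have hab' : FunctionallyIndependentOn (g.inv a) (g.inv b) P.V :=
    fun t ht => hab t (P.V_subset ht)
  have hφV := functionallyIndependentOn_image hP hab'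
  refine ⟨a, b, hab', hφV, fun t₀ ht₀ => ?_⟩
  have hs : ∀ c, ContDiffAt ℝ ∞ (g'.inv c) (P.φ t₀) := fun c =>
    (g'.smooth_inv c).contDiffAt (g'.isOpen_U.mem_nhds (P.mapsTo ht₀))
  -- As `I(t) = Ī(φ(t))`, the defining equations read `Ī(φ(t)) = Ī(t̄)`; local injectivity of the
  -- barred pair near `φ(t₀)` turns this into `t̄ = φ(t)`.
  obtain ⟨N, hN, hinj⟩ := exists_mem_nhds_injOn (hs a) (hs b) (hφV _ ⟨t₀, ht₀, rfl⟩)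
  have hφN : P.φ ⁻¹' N ∩ P.V ∈ 𝓝 t₀ :=
    Filter.inter_mem ((differentiableAt_φ ht₀).continuousAt hN) (P.isOpen_V.mem_nhds ht₀)
  rw [nhds_prod_eq]
  filter_upwards [Filter.prod_mem_prod hφN hN] with x hx
  obtain ⟨⟨hx1, hxV⟩, hx2⟩ := hx
  rw [inv_transform hP a hxV, inv_transform hP b hxV]
  constructor
  · rintro ⟨ha, hb⟩
    exact (hinj _ hx1 _ hx2 ha hb).symm
  · intro h
    rw [h]
    exact ⟨rfl, rfl⟩

/-- The transformation rules of the metric coefficients imply all other conditions. -/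
theorem conditions_of_condV (hP : P.CondV) (hgen : ∀ t ∈ g.U, g.ellC t * g.Crho t ≠ 0)
    (hind : ∃ a b : Fin 6, FunctionallyIndependentOn (g.inv a) (g.inv b) g.U) :
    P.Conditions :=
  have hρ : ∀ t ∈ g.U, g.Crho t ≠ 0 := fun t ht => right_ne_zero_of_mul (hgen t ht)
  ⟨condI_of_condV hP hind,
    condII_of_condV hP fun t ht => left_ne_zero_of_mul (hgen t ht),
    condIII_of_condV hP hρ, condIV_of_condV hP hρ, hP⟩

end AdaptedTransformation

/-! ### Isometries and adapted transformations -/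

theorem fderiv_fibered {φ ψ : Plane → Plane} {A : Mat2} {q : Plane × Plane}
    (hφ : DifferentiableAt ℝ φ q.1) (hψ : DifferentiableAt ℝ ψ q.1) (v : Plane × Plane) :
    fderiv ℝ (fun x : Plane × Plane => (φ x.1, A.mulVec x.2 + ψ x.1)) q v
      = ((jac φ q.1).mulVec v.1, A.mulVec v.2 + (jac ψ q.1).mulVec v.1) := by
  have h1 : HasFDerivAt (fun x : Plane × Plane => φ x.1) _ q :=
    hφ.hasFDerivAt.comp q hasFDerivAt_fst
  have h2 : HasFDerivAt (fun x : Plane × Plane => ψ x.1) _ q :=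
    hψ.hasFDerivAt.comp q hasFDerivAt_fst
  have h3 : HasFDerivAt (fun x : Plane × Plane => A.mulVec x.2) _ q :=
    (A.mulVecLin.toContinuousLinearMap.hasFDerivAt (x := q.2)).comp q hasFDerivAt_snd
  rw [(h1.prodMk (h3.fun_add h2)).fderiv, ← fderiv_eq_jac_mulVec hφ, ← fderiv_eq_jac_mulVec hψ]
  rfl

theorem fderiv_fibered_injective {φ ψ : Plane → Plane} {A : Mat2} {q : Plane × Plane}
    (hφ : DifferentiableAt ℝ φ q.1) (hψ : DifferentiableAt ℝ ψ q.1)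
    (hJ : (jac φ q.1).det ≠ 0) (hA : A.det ≠ 0) :
    Function.Injective
      (fderiv ℝ (fun x : Plane × Plane => (φ x.1, A.mulVec x.2 + ψ x.1)) q) := by
  intro v w h
  rw [fderiv_fibered hφ hψ, fderiv_fibered hφ hψ, Prod.mk.injEq] at h
  have h1 := mulVec_injective_of_det_ne hJ h.1
  have h2 := h.2
  rw [h1, add_left_inj] at h2
  exact Prod.ext h1 (mulVec_injective_of_det_ne hA h2)

theorem det_ne_of_fderiv_fibered_injective {φ ψ : Plane → Plane} {A : Mat2} {q : Plane × Plane}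
    (hφ : DifferentiableAt ℝ φ q.1) (hψ : DifferentiableAt ℝ ψ q.1) (hA : A.det ≠ 0)
    (h : Function.Injective
      (fderiv ℝ (fun x : Plane × Plane => (φ x.1, A.mulVec x.2 + ψ x.1)) q)) :
    (jac φ q.1).det ≠ 0 := by
  intro h0
  obtain ⟨v, hv, hv0⟩ := Matrix.exists_mulVec_eq_zero_iff.2 h0
  -- A kernel vector `v` of the Jacobian is completed by the vertical component that cancels
  -- `dψ(v)`, which exists because `A` is invertible.
  have hz : fderiv ℝ (fun x : Plane × Plane => (φ x.1, A.mulVec x.2 + ψ x.1)) q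
      (v, -A⁻¹.mulVec ((jac ψ q.1).mulVec v)) = 0 := by
    rw [fderiv_fibered hφ hψ, hv0, Matrix.mulVec_neg, Matrix.mulVec_mulVec,
      Matrix.mul_nonsing_inv _ (isUnit_iff_ne_zero.2 hA), Matrix.one_mulVec, neg_add_cancel]
    rfl
  exact hv (congrArg Prod.fst ((map_eq_zero_iff _ h).1 hz))

/-! ### Transformation rules versus the pullback identity -/

namespace AdaptedTransformation

variable {g g' : AdaptedMetric} {P : AdaptedTransformation g g'}

theorem fderiv_toMap {q : Plane × Plane} (hq : q.1 ∈ P.V) (v : Plane × Plane) :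
    fderiv ℝ P.toMap q v
      = ((jac P.φ q.1).mulVec v.1, P.α.val.mulVec v.2 + (jac P.ψ q.1).mulVec v.1) :=
  fderiv_fibered (differentiableAt_φ hq) (differentiableAt_ψ hq) v

theorem contDiffAt_toMap {q : Plane × Plane} (hq : q.1 ∈ P.V) : ContDiffAt ℝ ∞ P.toMap q := by
  have hφ : ContDiffAt ℝ ∞ P.φ q.1 := P.smooth_φ.contDiffAt (P.isOpen_V.mem_nhds hq)
  have hψ : ContDiffAt ℝ ∞ P.ψ q.1 := P.smooth_ψ.contDiffAt (P.isOpen_V.mem_nhds hq)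
  have hα : ContDiffAt ℝ ∞ (fun x : Plane × Plane => P.α.val.mulVec x.2) q :=
    (P.α.val.mulVecLin.toContinuousLinearMap.contDiff.comp contDiff_snd).contDiffAt
  exact (hφ.comp q contDiffAt_fst).prodMk (hα.add (hψ.comp q contDiffAt_fst))

/-- The transformation rules say that the transformation pulls `g'` back to `g`. -/
theorem form_toMap (hP : P.CondV) {q : Plane × Plane} (hq : q.1 ∈ P.V) (v w : Plane × Plane) :
    g'.form (P.toMap q) (fderiv ℝ P.toMap q v) (fderiv ℝ P.toMap q w) = g.form q v w := by
  have hs := (g'.symm_h _ (P.mapsTo hq)).apply 0 1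
  obtain ⟨hb, hf, hh⟩ := hP q.1 hq
  rw [fderiv_toMap hq, fderiv_toMap hq]
  simp only [AdaptedMetric.form, toMap, hb, hf, hh, Fin.sum_univ_two, Matrix.mulVec, dotProduct,
    Pi.add_apply, hs]
  ring

/-- Neither metric depends on the leaf coordinates and the differential of `P.toMap` is independent
of `z`, so one point on each leaf suffices. The three rules come from evaluation on pairs of
coordinate vectors. -/
theorem condV_of_form_toMap
    (h : ∀ t ∈ P.V, ∃ z, ∀ v w : Plane × Plane,
      g'.form (P.toMap (t, z)) (fderiv ℝ P.toMap (t, z) v) (fderiv ℝ P.toMap (t, z) w)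
        = g.form (t, z) v w) : P.CondV := by
  intro t ht
  obtain ⟨z, hz⟩ := h t ht
  have hs := (g'.symm_h _ (P.mapsTo ht)).apply 0 1
  have hm : ∀ (A : Mat2) (i k : Fin 2), A.mulVec (Pi.single i 1) k = A k i := fun A i k => by
    simp
  refine ⟨fun i j => ?_, fun i k => ?_, fun k l => ?_⟩
  · have := hz (Pi.single i 1, 0) (Pi.single j 1, 0)
    rw [fderiv_toMap ht, fderiv_toMap ht] at this
    simp only [AdaptedMetric.form, toMap, Matrix.mulVec_zero, zero_add, hm, Pi.zero_apply,
      mul_zero, add_zero, Finset.sum_const_zero, Pi.single_apply, mul_ite, mul_one,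
      Finset.sum_ite_eq', Finset.mem_univ, if_true] at this
    exact this.symm
  · have := hz (Pi.single i 1, 0) (0, Pi.single k 1)
    rw [fderiv_toMap ht, fderiv_toMap ht] at this
    simp only [AdaptedMetric.form, toMap, Matrix.mulVec_zero, zero_add, hm, Pi.zero_apply,
      mul_zero, add_zero, zero_mul, Finset.sum_const_zero, Pi.single_apply, mul_ite, mul_one,
      Finset.sum_ite_eq', Finset.mem_univ, if_true] at this
    rw [← this]
    simp only [Fin.sum_univ_two, hs]
    ring
  · have := hz (0, Pi.single k 1) (0, Pi.single l 1)
    rw [fderiv_toMap ht, fderiv_toMap ht] at this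
    simp only [AdaptedMetric.form, toMap, Matrix.mulVec_zero, zero_add, hm, Pi.zero_apply,
      mul_zero, add_zero, zero_mul, Finset.sum_const_zero, ite_self, Pi.single_apply, mul_ite, mul_one,
      Finset.sum_ite_eq', Finset.mem_univ, if_true] at this
    exact this.symm

theorem equivalentAt (hP : P.CondV) {p : Plane × Plane} (hp : p.1 ∈ P.V) :
    EquivalentAt g g' p (P.toMap p) := by
  have hinj : ∀ q : Plane × Plane, q.1 ∈ P.V → Function.Injective (fderiv ℝ P.toMap q) :=
    fun q hq => fderiv_fibered_injective (differentiableAt_φ hq) (differentiableAt_ψ hq)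
      (P.jacobian_ne _ hq) P.det_α_ne
  obtain ⟨e, he, hfe⟩ := exists_openPartialHomeomorph (contDiffAt_toMap hp) (hinj p hp)
  have hV : IsOpen {q : Plane × Plane | q.1 ∈ P.V} := P.isOpen_V.preimage continuous_fst
  have hsrc : (e.restrOpen _ hV).source = e.source ∩ {q | q.1 ∈ P.V} :=
    e.restrOpen_source _ hV
  have hcoe : ⇑(e.restrOpen _ hV) = P.toMap := hfe
  generalize e.restrOpen _ hV = Φ at hsrc hcoe
  have hΦV : ∀ q ∈ Φ.source, q.1 ∈ P.V := fun q hq => (hsrc ▸ hq).2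
  refine ⟨Φ, hsrc ▸ ⟨he, hp⟩, by rw [hcoe], fun q hq => P.V_subset (hΦV q hq), ?_, ?_, ?_, ?_⟩
  · intro y hy
    rw [← Φ.right_inv hy, hcoe]
    exact P.mapsTo (hΦV _ (Φ.map_target hy))
  · rw [hcoe]
    exact fun q hq => (contDiffAt_toMap (hΦV q hq)).contDiffWithinAt
  · intro y hy
    have hq := hΦV _ (Φ.map_target hy)
    -- The inverse is so far only known to be continuous; the invertible differential at each point
    -- of the source makes it smooth.
    obtain ⟨L, hL⟩ := exists_continuousLinearEquiv (hinj _ hq)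
    refine (Φ.contDiffAt_symm (f₀' := L) hy ?_ ?_).contDiffWithinAt
    · rw [hL, hcoe]
      exact ((contDiffAt_toMap hq).differentiableAt (by simp)).hasFDerivAt
    · rw [hcoe]
      exact contDiffAt_toMap hq
  · intro q hq v w
    rw [hcoe]
    exact form_toMap hP (hΦV q hq) v w

end AdaptedTransformation

/-! ### Bilinearity and differentiation of the metric form -/

namespace AdaptedMetric

variable (g : AdaptedMetric)

theorem form_add_left (q u v w : Plane × Plane) :
    g.form q (u + v) w = g.form q u w + g.form q v w := by
  simp only [form, Fin.sum_univ_two, Prod.fst_add, Prod.snd_add, Pi.add_apply]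
  ring

theorem form_smul_left (q v w : Plane × Plane) (c : ℝ) :
    g.form q (c • v) w = c * g.form q v w := by
  simp only [form, Fin.sum_univ_two, Prod.smul_fst, Prod.smul_snd, Pi.smul_apply, smul_eq_mul]
  ring

theorem form_add_right (q u v w : Plane × Plane) :
    g.form q w (u + v) = g.form q w u + g.form q w v := by
  simp only [form, Fin.sum_univ_two, Prod.fst_add, Prod.snd_add, Pi.add_apply]
  ring

theorem form_smul_right (q v w : Plane × Plane) (c : ℝ) :
    g.form q w (c • v) = c * g.form q w v := by
  simp only [form, Fin.sum_univ_two, Prod.smul_fst, Prod.smul_snd, Pi.smul_apply, smul_eq_mul]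
  ring

theorem fderiv_form_left (q v w u : Plane × Plane) :
    fderiv ℝ (fun x => g.form q x w) v u = g.form q u w := by
  let L : (Plane × Plane) →ₗ[ℝ] ℝ :=
    ⟨⟨fun x => g.form q x w, fun _ _ => g.form_add_left _ _ _ _⟩,
      fun _ _ => g.form_smul_left _ _ _ _⟩
  exact DFunLike.congr_fun (L.toContinuousLinearMap.hasFDerivAt (x := v)).fderiv u

theorem fderiv_form_right (q v w u : Plane × Plane) :
    fderiv ℝ (fun x => g.form q v x) w u = g.form q v u := by
  let L : (Plane × Plane) →ₗ[ℝ] ℝ :=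
    ⟨⟨fun x => g.form q v x, fun _ _ => g.form_add_right _ _ _ _⟩,
      fun _ _ => g.form_smul_right _ _ _ _⟩
  exact DFunLike.congr_fun (L.toContinuousLinearMap.hasFDerivAt (x := w)).fderiv u

theorem differentiableAt_form {E : Type*} [NormedAddCommGroup E] [NormedSpace ℝ E]
    {y v w : E → Plane × Plane} {q : E} (hq : y q ∈ g.domain) (hy : DifferentiableAt ℝ y q)
    (hv : DifferentiableAt ℝ v q) (hw : DifferentiableAt ℝ w q) :
    DifferentiableAt ℝ (fun x => g.form (y x) (v x) (w x)) q := by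
  have comp : ∀ {A : Plane → ℝ}, ContDiffOn ℝ ∞ A g.U → DifferentiableAt ℝ (fun x => A (y x).1) q :=
    fun hA => DifferentiableAt.fun_comp' (g := _) (f := fun x => (y x).1) q
      (differentiableAt_of_contDiffOn hA g.isOpen_U hq) hy.fst
  have h1 : ∀ {u : E → Plane × Plane}, DifferentiableAt ℝ u q →
      ∀ i, DifferentiableAt ℝ (fun x => (u x).1 i) q :=
    fun hu i => differentiableAt_pi.1 hu.fst i
  have h2 : ∀ {u : E → Plane × Plane}, DifferentiableAt ℝ u q →
      ∀ i, DifferentiableAt ℝ (fun x => (u x).2 i) q :=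
    fun hu i => differentiableAt_pi.1 hu.snd i
  refine DifferentiableAt.fun_add (DifferentiableAt.fun_add ?_ ?_) ?_
  · exact DifferentiableAt.fun_sum fun i _ => DifferentiableAt.fun_sum fun j _ =>
      ((comp (g.smooth_b i j)).fun_mul (h1 hv i)).fun_mul (h1 hw j)
  · exact DifferentiableAt.fun_sum fun i _ => DifferentiableAt.fun_sum fun j _ =>
      (comp (g.smooth_f i j)).fun_mul
        (((h1 hv i).fun_mul (h2 hw j)).fun_add ((h1 hw i).fun_mul (h2 hv j)))
  · exact DifferentiableAt.fun_sum fun i _ => DifferentiableAt.fun_sum fun j _ =>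
      ((comp (g.smooth_h i j)).fun_mul (h2 hv i)).fun_mul (h2 hw j)

/-- The product rule for `g_{y(x)}(v(x), w(x))`. -/
theorem fderiv_form {E : Type} [NormedAddCommGroup E] [NormedSpace ℝ E]
    {y v w : E → Plane × Plane} {q : E} (hq : y q ∈ g.domain) (hy : DifferentiableAt ℝ y q)
    (hv : DifferentiableAt ℝ v q) (hw : DifferentiableAt ℝ w q) (u : E) :
    fderiv ℝ (fun x => g.form (y x) (v x) (w x)) q u
      = fderiv ℝ (fun x => g.form x (v q) (w q)) (y q) (fderiv ℝ y q u)
        + g.form (y q) (fderiv ℝ v q u) (w q) + g.form (y q) (v q) (fderiv ℝ w q u) := by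
  -- With base point and both arguments taken as one variable, the derivative of `G` is linear, so
  -- it splits into the contributions of the three slots; `e1`, `e2` and `e3` identify them by
  -- varying one slot at a time.
  let G : (Plane × Plane) × (Plane × Plane) × (Plane × Plane) → ℝ :=
    fun x => g.form x.1 x.2.1 x.2.2
  have hG : DifferentiableAt ℝ G (y q, v q, w q) :=
    g.differentiableAt_form hq differentiableAt_fst differentiableAt_snd.fst
      differentiableAt_snd.snd
  have key : ∀ {F : Type} [NormedAddCommGroup F] [NormedSpace ℝ F]
      {k : F → (Plane × Plane) × (Plane × Plane) × (Plane × Plane)} {k' : F →L[ℝ] _} {x : F},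
      HasFDerivAt k k' x → k x = (y q, v q, w q) → ∀ a,
        fderiv ℝ (fun x => G (k x)) x a = fderiv ℝ G (y q, v q, w q) (k' a) := by
    intro F _ _ k k' x hk hx a
    have hG' : HasFDerivAt G (fderiv ℝ G (y q, v q, w q)) (k x) := hx ▸ hG.hasFDerivAt
    exact DFunLike.congr_fun (hG'.comp x hk).fderiv a
  have hcomp := key (hy.hasFDerivAt.prodMk (hv.hasFDerivAt.prodMk hw.hasFDerivAt)) rfl u
  have e1 := key ((hasFDerivAt_id (𝕜 := ℝ) (y q)).prodMk (hasFDerivAt_const (v q, w q) _)) rfl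
    (fderiv ℝ y q u)
  have e2 := key ((hasFDerivAt_const (y q) _).prodMk
    ((hasFDerivAt_id (𝕜 := ℝ) (v q)).prodMk (hasFDerivAt_const (w q) _))) rfl (fderiv ℝ v q u)
  have e3 := key ((hasFDerivAt_const (y q) _).prodMk
    ((hasFDerivAt_const (v q) _).prodMk (hasFDerivAt_id (𝕜 := ℝ) (w q)))) rfl (fderiv ℝ w q u)
  have l2 := g.fderiv_form_left (y q) (v q) (w q) (fderiv ℝ v q u)
  have l3 := g.fderiv_form_right (y q) (v q) (w q) (fderiv ℝ w q u)
  rw [← l2, ← l3]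
  refine hcomp.trans ?_
  refine Eq.trans ?_ (congrArg₂ (· + ·) (congrArg₂ (· + ·) e1 e2) e3).symm
  rw [← map_add, ← map_add]
  simp

/-- The metric is invariant under translations along the leaves. -/
theorem fderiv_form_vertical {q : Plane × Plane} (hq : q ∈ g.domain) (v w : Plane × Plane)
    (c : Plane) : fderiv ℝ (fun x => g.form x v w) q (0, c) = 0 := by
  have hd : DifferentiableAt ℝ (fun t : Plane => g.form (t, 0) v w) q.1 :=
    g.differentiableAt_form (y := fun t : Plane => (t, (0 : Plane))) hq
      (differentiableAt_id.prodMk (differentiableAt_const _))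
      (differentiableAt_const _) (differentiableAt_const _)
  have h : HasFDerivAt (fun x : Plane × Plane => g.form x v w) _ q :=
    hd.hasFDerivAt.comp q hasFDerivAt_fst
  rw [h.fderiv]
  simp

end AdaptedMetric

/-! ### Rigidity of isometries: pullback of Killing fields and the fibred form -/

/-- A smooth diffeomorphism between open sets that pulls `g'` back to `g`. -/
structure IsLocalIsometry (g g' : AdaptedMetric)
    (Φ : OpenPartialHomeomorph (Plane × Plane) (Plane × Plane)) : Prop where
  source_subset : Φ.source ⊆ g.domain
  target_subset : Φ.target ⊆ g'.domain
  smooth : ContDiffOn ℝ ∞ Φ Φ.source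
  smooth_symm : ContDiffOn ℝ ∞ Φ.symm Φ.target
  pullback : ∀ q ∈ Φ.source, ∀ v w : Plane × Plane,
    g'.form (Φ q) (fderiv ℝ Φ q v) (fderiv ℝ Φ q w) = g.form q v w

namespace IsLocalIsometry

variable {g g' : AdaptedMetric} {Φ : OpenPartialHomeomorph (Plane × Plane) (Plane × Plane)}

theorem differentiableAt (hΦ : IsLocalIsometry g g' Φ) {q : Plane × Plane} (hq : q ∈ Φ.source) :
    DifferentiableAt ℝ Φ q :=
  differentiableAt_of_contDiffOn hΦ.smooth Φ.open_source hq

theorem differentiableAt_symm (hΦ : IsLocalIsometry g g' Φ) {y : Plane × Plane}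
    (hy : y ∈ Φ.target) : DifferentiableAt ℝ Φ.symm y :=
  differentiableAt_of_contDiffOn hΦ.smooth_symm Φ.open_target hy

theorem fderiv_fderiv_symm (hΦ : IsLocalIsometry g g' Φ) {q : Plane × Plane}
    (hq : q ∈ Φ.source) (k : Plane × Plane) :
    fderiv ℝ Φ q (fderiv ℝ Φ.symm (Φ q) k) = k := by
  have hs := (hΦ.differentiableAt_symm (Φ.map_source hq)).hasFDerivAt
  have hd : HasFDerivAt Φ (fderiv ℝ Φ q) (Φ.symm (Φ q)) := by
    rw [Φ.left_inv hq]; exact (hΦ.differentiableAt hq).hasFDerivAt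
  have hid : (Φ ∘ Φ.symm) =ᶠ[𝓝 (Φ q)] id := by
    filter_upwards [Φ.open_target.mem_nhds (Φ.map_source hq)] with y hy using Φ.right_inv hy
  have := ((hd.comp (Φ q) hs).congr_of_eventuallyEq hid.symm).unique (hasFDerivAt_id (Φ q))
  exact DFunLike.congr_fun this k

theorem fderiv_symm_fderiv (hΦ : IsLocalIsometry g g' Φ) {q : Plane × Plane}
    (hq : q ∈ Φ.source) (k : Plane × Plane) :
    fderiv ℝ Φ.symm (Φ q) (fderiv ℝ Φ q k) = k := by
  have hs := (hΦ.differentiableAt_symm (Φ.map_source hq)).hasFDerivAt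
  have hid : (Φ.symm ∘ Φ) =ᶠ[𝓝 q] id := by
    filter_upwards [Φ.open_source.mem_nhds hq] with y hy using Φ.left_inv hy
  have := ((hs.comp q (hΦ.differentiableAt hq).hasFDerivAt).congr_of_eventuallyEq
    hid.symm).unique (hasFDerivAt_id q)
  exact DFunLike.congr_fun this k

theorem fderiv_injective (hΦ : IsLocalIsometry g g' Φ) {q : Plane × Plane}
    (hq : q ∈ Φ.source) : Function.Injective (fderiv ℝ Φ q) :=
  Function.LeftInverse.injective (hΦ.fderiv_symm_fderiv hq)

/-- The pullback of a constant field along an isometry is smooth. -/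
theorem smooth_pullbackField (hΦ : IsLocalIsometry g g' Φ) (k : Plane × Plane) :
    ContDiffOn ℝ ∞ (fun q => fderiv ℝ Φ.symm (Φ q) k) Φ.source :=
  ((hΦ.smooth_symm.fderiv_of_isOpen Φ.open_target (m := ∞) (by simp)).comp hΦ.smooth
    fun _ hq => Φ.map_source hq).clm_apply contDiffOn_const

/-- Isometries pull the Killing fields `∂/∂z̄` back to Killing fields. -/
theorem isKillingOn_pullbackField (hΦ : IsLocalIsometry g g' Φ) (c : Plane) :
    g.IsKillingOn (fun q => fderiv ℝ Φ.symm (Φ q) (0, c)) Φ.source := by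
  intro q hq v w
  set X : Plane × Plane → Plane × Plane := fun q => fderiv ℝ Φ.symm (Φ q) (0, c) with hX
  have hXd : DifferentiableAt ℝ X q :=
    differentiableAt_of_contDiffOn (hΦ.smooth_pullbackField (0, c)) Φ.open_source hq
  have hFd : DifferentiableAt ℝ (fderiv ℝ Φ) q :=
    differentiableAt_of_contDiffOn (hΦ.smooth.fderiv_of_isOpen Φ.open_source (m := ∞) (by simp))
      Φ.open_source hq
  have hFX : fderiv ℝ Φ q (X q) = (0, c) := hΦ.fderiv_fderiv_symm hq _
  have hsymm : IsSymmSndFDerivAt ℝ Φ q :=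
    (hΦ.smooth.contDiffAt (Φ.open_source.mem_nhds hq)).isSymmSndFDerivAt
      (by simpa using WithTop.coe_le_coe.2 (le_top : (2 : ℕ∞) ≤ ⊤))
  -- Differentiating the constant `DΦ(X) = (0, c)` in direction `u` gives `D²Φ(u, X) + DΦ(DX u) =
  -- 0`, and `D²Φ` is symmetric.
  have hdF : ∀ u, fderiv ℝ (fun r => fderiv ℝ Φ r u) q (X q)
      = -fderiv ℝ Φ q (fderiv ℝ X q u) := by
    intro u
    have hconst : (fun r => fderiv ℝ Φ r (X r)) =ᶠ[𝓝 q] fun _ => ((0 : Plane), c) := by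
      filter_upwards [Φ.open_source.mem_nhds hq] with r hr using hΦ.fderiv_fderiv_symm hr _
    have h0 : fderiv ℝ (fun r => fderiv ℝ Φ r (X r)) q u = 0 := by
      rw [hconst.fderiv_eq]; simp
    rw [fderiv_clm_apply hFd hXd] at h0
    rw [fderiv_clm_apply hFd (differentiableAt_const u)]
    simp only [add_apply, ContinuousLinearMap.comp_apply,
      ContinuousLinearMap.flip_apply, fderiv_fun_const, Pi.zero_apply,
      zero_apply, map_zero, zero_add] at h0 ⊢
    rw [hsymm.eq (X q) u]
    exact eq_neg_of_add_eq_zero_right h0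
  have hform : (fun r => g.form r v w) =ᶠ[𝓝 q]
      fun r => g'.form (Φ r) (fderiv ℝ Φ r v) (fderiv ℝ Φ r w) := by
    filter_upwards [Φ.open_source.mem_nhds hq] with r hr using (hΦ.pullback r hr v w).symm
  have hneg : ∀ (y a b : Plane × Plane), g'.form y (-a) b = -g'.form y a b := fun y a b => by
    have := g'.form_smul_left y a b (-1); simpa using this
  have hneg' : ∀ (y a b : Plane × Plane), g'.form y b (-a) = -g'.form y b a := fun y a b => by
    have := g'.form_smul_right y a b (-1); simpa using this
  have hq' : Φ q ∈ g'.domain := hΦ.target_subset (Φ.map_source hq)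
  -- The derivative of `g'` along `(0, c)` vanishes, and by `hdF` the other two terms of the product
  -- rule cancel the terms of the Killing equation containing `DX`.
  rw [hform.fderiv_eq, g'.fderiv_form hq' (hΦ.differentiableAt hq)
    (hFd.clm_apply (differentiableAt_const v)) (hFd.clm_apply (differentiableAt_const w)),
    hdF, hdF, hFX, g'.fderiv_form_vertical hq', hneg, hneg', hΦ.pullback q hq,
    hΦ.pullback q hq]
  ring

/-- If the Killing algebra of `g` is spanned by `∂/∂z¹`, `∂/∂z²`, then the differential of an
isometry restricted to the leaves is a constant linear map. -/
theorem exists_vertical_linear (hΦ : IsLocalIsometry g g' Φ) (hg : g.KillingAlgebraIsG2)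
    {W : Set (Plane × Plane)} (hWo : IsOpen W) (hWc : IsPreconnected W) (hW : W ⊆ Φ.source)
    (hne : W.Nonempty) :
    ∃ A : Mat2, A.det ≠ 0 ∧ ∀ q ∈ W, ∀ v : Plane, fderiv ℝ Φ q (0, v) = (0, A.mulVec v) := by
  obtain ⟨p, hp⟩ := hne
  have hκ : ∀ c : Plane, ∃ d : Plane, ∀ q ∈ W, fderiv ℝ Φ.symm (Φ q) (0, c) = (0, d) :=
    fun c => hg W hWo hWc (hW.trans hΦ.source_subset) _ ((hΦ.smooth_pullbackField (0, c)).mono hW)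
      fun q hq => hΦ.isKillingOn_pullbackField c q (hW hq)
  -- The vertical block of `(DΦ)⁻¹` at the single point `p`. The Killing hypothesis makes this block
  -- the same throughout `W`, and the matrix sought is its inverse.
  let K : Plane →ₗ[ℝ] Plane :=
    (LinearMap.snd ℝ Plane Plane) ∘ₗ (fderiv ℝ Φ.symm (Φ p)).toLinearMap ∘ₗ
      (LinearMap.inr ℝ Plane Plane)
  have hK : ∀ c, ∀ q ∈ W, fderiv ℝ Φ q (0, K c) = (0, c) := by
    intro c q hq
    obtain ⟨d, hd⟩ := hκ c
    have hKc : K c = d := congrArg Prod.snd (hd p hp)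
    rw [hKc, ← hd q hq]
    exact hΦ.fderiv_fderiv_symm (hW hq) _
  have hinj : Function.Injective K := by
    intro a b hab
    have h := hK a p hp
    rw [hab, hK b p hp] at h
    exact (congrArg Prod.snd h).symm
  let e := LinearEquiv.ofInjectiveEndo K hinj
  refine ⟨LinearMap.toMatrix' (e.symm : Plane →ₗ[ℝ] Plane), ?_, fun q hq v => ?_⟩
  · rw [LinearMap.det_toMatrix']
    exact (LinearEquiv.isUnit_det' e.symm).ne_zero
  · rw [LinearMap.toMatrix'_mulVec, LinearEquiv.coe_coe, ← hK (e.symm v) q hq]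
    congr 2
    exact (e.apply_symm_apply v).symm

/-- On each vertical slice `Φ - (0, A z)` has zero derivative, so it keeps the value it takes at `z
= p.2`. -/
theorem eq_fibered (hΦ : IsLocalIsometry g g' Φ) {p : Plane × Plane} {r : ℝ}
    (hr : Metric.ball p r ⊆ Φ.source) {A : Mat2}
    (hA : ∀ q ∈ Metric.ball p r, ∀ v : Plane, fderiv ℝ Φ q (0, v) = (0, A.mulVec v))
    {q : Plane × Plane} (hq : q ∈ Metric.ball p r) :
    Φ q = ((Φ (q.1, p.2)).1, A.mulVec q.2 + ((Φ (q.1, p.2)).2 - A.mulVec p.2)) := by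
  obtain ⟨t, z⟩ := q
  -- A ball for the product norm is a product of balls, so its vertical slices are connected and all
  -- meet `z = p.2`.
  rw [← ball_prod_same] at hq hr hA
  obtain ⟨ht : t ∈ Metric.ball p.1 r, hz : z ∈ Metric.ball p.2 r⟩ := hq
  have hr0 : 0 < r := Metric.pos_of_mem_ball hz
  have hd : ∀ x ∈ Metric.ball p.2 r,
      HasFDerivAt (fun x => Φ (t, x) - (0, A.mulVec x)) (0 : Plane →L[ℝ] Plane × Plane) x := by
    intro x hx
    have h1 : HasFDerivAt (fun x => Φ (t, x))
        ((fderiv ℝ Φ (t, x)).comp ((0 : Plane →L[ℝ] Plane).prod (ContinuousLinearMap.id ℝ Plane)))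
        x :=
      (hΦ.differentiableAt (hr ⟨ht, hx⟩)).hasFDerivAt.comp x
        ((hasFDerivAt_const t x).prodMk (hasFDerivAt_id x))
    have h2 : HasFDerivAt (fun x => ((0 : Plane), A.mulVec x))
        ((0 : Plane →L[ℝ] Plane).prod A.mulVecLin.toContinuousLinearMap) x :=
      (hasFDerivAt_const (0 : Plane) x).prodMk A.mulVecLin.toContinuousLinearMap.hasFDerivAt
    refine (h1.fun_sub h2).congr_fderiv ?_
    refine ContinuousLinearMap.ext fun v => ?_
    have := hA (t, x) ⟨ht, hx⟩ v
    simp [this]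
  have hconst : Φ (t, z) - (0, A.mulVec z) = Φ (t, p.2) - (0, A.mulVec p.2) :=
    Metric.isOpen_ball.is_const_of_fderiv_eq_zero (𝕜 := ℝ)
      (convex_ball p.2 r).isPreconnected
      (fun x hx => (hd x hx).differentiableAt.differentiableWithinAt)
      (fun x hx => (hd x hx).fderiv) hz (Metric.mem_ball_self hr0)
  have h1 := congrArg Prod.fst hconst
  have h2 := congrArg Prod.snd hconst
  simp only [Prod.fst_sub, Prod.snd_sub, sub_zero] at h1 h2
  refine Prod.ext h1 ?_
  rw [← h2]
  exact (add_sub_cancel _ _).symm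

/-- Every local isometry is locally an adapted transformation. -/
theorem exists_adaptedTransformation (hΦ : IsLocalIsometry g g' Φ) (hg : g.KillingAlgebraIsG2)
    {p : Plane × Plane} (hp : p ∈ Φ.source) :
    ∃ P : AdaptedTransformation g g', p.1 ∈ P.V ∧ P.toMap p = Φ p ∧ P.CondV := by
  obtain ⟨r, hr0, hr⟩ := Metric.isOpen_iff.1 Φ.open_source p hp
  obtain ⟨A, hdet, hA⟩ := hΦ.exists_vertical_linear hg Metric.isOpen_ball
    (convex_ball p r).isPreconnected hr ⟨p, Metric.mem_ball_self hr0⟩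
  have hmem : ∀ t ∈ Metric.ball p.1 r, (t, p.2) ∈ Metric.ball p r := fun t ht => by
    rw [← ball_prod_same]; exact ⟨ht, Metric.mem_ball_self hr0⟩
  let φ : Plane → Plane := fun t => (Φ (t, p.2)).1
  let ψ : Plane → Plane := fun t => (Φ (t, p.2)).2 - A.mulVec p.2
  have hslice : ContDiffOn ℝ ∞ (fun t => Φ (t, p.2)) (Metric.ball p.1 r) :=
    hΦ.smooth.comp (contDiffOn_id.prodMk contDiffOn_const) fun t ht => hr (hmem t ht)
  have hφ : ContDiffOn ℝ ∞ φ (Metric.ball p.1 r) := hslice.fst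
  have hψ : ContDiffOn ℝ ∞ ψ (Metric.ball p.1 r) := hslice.snd.sub contDiffOn_const
  have hφd : ∀ t ∈ Metric.ball p.1 r, DifferentiableAt ℝ φ t := fun t ht =>
    differentiableAt_of_contDiffOn hφ Metric.isOpen_ball ht
  have hψd : ∀ t ∈ Metric.ball p.1 r, DifferentiableAt ℝ ψ t := fun t ht =>
    differentiableAt_of_contDiffOn hψ Metric.isOpen_ball ht
  have heq : ∀ q ∈ Metric.ball p r, Φ q = (φ q.1, A.mulVec q.2 + ψ q.1) :=
    fun q hq => hΦ.eq_fibered hr hA hq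
  have hev : ∀ q ∈ Metric.ball p r,
      Φ =ᶠ[𝓝 q] fun x : Plane × Plane => (φ x.1, A.mulVec x.2 + ψ x.1) := fun q hq => by
    filter_upwards [Metric.isOpen_ball.mem_nhds hq] with x hx using heq x hx
  have hJ : ∀ t ∈ Metric.ball p.1 r, (jac φ t).det ≠ 0 := fun t ht => by
    refine det_ne_of_fderiv_fibered_injective (q := (t, p.2)) (hφd t ht) (hψd t ht) hdet ?_
    rw [← (hev _ (hmem t ht)).fderiv_eq]
    exact hΦ.fderiv_injective (hr (hmem t ht))
  have hp1 : p.1 ∈ Metric.ball p.1 r := Metric.mem_ball_self hr0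
  -- The inverse function theorem supplies a smaller neighbourhood of `p.1` on which `φ` is
  -- injective.
  obtain ⟨e, he, hfe⟩ := exists_openPartialHomeomorph
    (hφ.contDiffAt (Metric.isOpen_ball.mem_nhds hp1))
    (fderiv_injective_of_jac (hφd _ hp1) (hJ _ hp1))
  let P : AdaptedTransformation g g' :=
    { V := Metric.ball p.1 r ∩ e.source
      isOpen_V := Metric.isOpen_ball.inter e.open_source
      V_subset := fun t ht => hΦ.source_subset (hr (hmem t ht.1))
      φ := φ
      ψ := ψ
      α := Matrix.GeneralLinearGroup.mkOfDetNeZero A hdet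
      smooth_φ := hφ.mono Set.inter_subset_left
      smooth_ψ := hψ.mono Set.inter_subset_left
      mapsTo := fun t ht => hΦ.target_subset (Φ.map_source (hr (hmem t ht.1)))
      injOn := fun x hx y hy h => e.injOn hx.2 hy.2 (by rwa [hfe])
      jacobian_ne := fun t ht => hJ t ht.1 }
  have hPmap : P.toMap = fun x : Plane × Plane => (φ x.1, A.mulVec x.2 + ψ x.1) := rfl
  -- `P` lives over all of `V × ℝ²` and agrees with `Φ` only on the ball; checking the pullback on
  -- the slice `z = p.2` is enough for the rules over `V`.
  refine ⟨P, ⟨hp1, he⟩, (heq p (Metric.mem_ball_self hr0)).symm,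
    AdaptedTransformation.condV_of_form_toMap fun t ht => ⟨p.2, fun v w => ?_⟩⟩
  have hq := hmem t ht.1
  have hPq : P.toMap (t, p.2) = Φ (t, p.2) := (heq _ hq).symm
  rw [hPq, hPmap, ← (hev _ hq).fderiv_eq]
  exact hΦ.pullback _ (hr hq) v w

end IsLocalIsometry

/-! ### The equivalence criterion -/

theorem equivalentAt_iff {g g' : AdaptedMetric} (hg : g.KillingAlgebraIsG2)
    (hgen : ∀ t ∈ g.U, g.ellC t * g.Crho t ≠ 0)
    (hind : ∃ a b : Fin 6, FunctionallyIndependentOn (g.inv a) (g.inv b) g.U)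
    (p p' : Plane × Plane) :
    EquivalentAt g g' p p' ↔
      ∃ P : AdaptedTransformation g g', p.1 ∈ P.V ∧ P.toMap p = p' ∧ P.Conditions := by
  constructor
  · rintro ⟨Φ, hp, rfl, h1, h2, h3, h4, h5⟩
    obtain ⟨P, hpV, hPp, hP⟩ :=
      (IsLocalIsometry.mk h1 h2 h3 h4 h5).exists_adaptedTransformation hg hp
    exact ⟨P, hpV, hPp, P.conditions_of_condV hP hgen hind⟩
  · rintro ⟨P, hp, rfl, hP⟩
    exact P.equivalentAt hP.2.2.2.2 hp

end

theorem mainTheorem3 (g g' : AdaptedMetric)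
    (hg : g.KillingAlgebraIsG2) (hg' : g'.KillingAlgebraIsG2)
    (hgen : ∀ t ∈ g.U, g.ellC t * g.Crho t ≠ 0)
    (hgen' : ∀ t ∈ g'.U, g'.ellC t * g'.Crho t ≠ 0)
    (hind : ∃ a b : Fin 6, FunctionallyIndependentOn (g.inv a) (g.inv b) g.U) :
    (Equivalent g g' ↔
      ∃ P : AdaptedTransformation g g', P.V.Nonempty ∧ P.Conditions) ∧
    ∀ p ∈ g.domain, ∀ p' ∈ g'.domain,
      (EquivalentAt g g' p p' ↔
        ∃ P : AdaptedTransformation g g', p.1 ∈ P.V ∧ P.toMap p = p' ∧ P.Conditions) := by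
  refine ⟨⟨?_, ?_⟩, fun p _ p' _ => equivalentAt_iff hg hgen hind p p'⟩
  · rintro ⟨p, _, p', _, h⟩
    obtain ⟨P, hp, _, hP⟩ := (equivalentAt_iff hg hgen hind p p').1 h
    exact ⟨P, ⟨_, hp⟩, hP⟩
  · rintro ⟨P, ⟨t, ht⟩, hP⟩
    exact ⟨(t, 0), P.V_subset ht, P.toMap (t, 0), P.mapsTo ht,
      (equivalentAt_iff hg hgen hind _ _).2 ⟨P, ht, rfl, hP⟩⟩
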